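/- **Setting.** Let $d \ge 0$, write points of $\mathbb{C}^{d+1}=\mathbb{C}\times\mathbb{C}^d$ as $(z_0,z_1,\dots,z_d)$, and let $e_0,\dots,e_d$ be the standard basis. Let $\mathbb{D}$ be the open unit disk in $\mathbb{C}$ and, for $0\le i\le d$, let $Z_i = e_i+\operatorname{span}_{\mathbb{C}}\{e_j : j>i\}$. A convex domain is a non-empty open convex set. Let $\mathbb{X}_{d+1,0}$ be the set of pairs $(\Omega,x)$, where $\Omega\subset\mathbb{C}^{d+1}$ is a convex domain containing no complex affine line and $x\in\Omega$. A sequence $(\Omega_n,x_n)$ in $\mathbb{X}_{d+1,0}$ converges to $(\Omega_\infty,x_\infty)\in\mathbb{X}_{d+1,0}$ if $x_n\to x_\infty$ and there is $R_0\ge 0$ such that, for all $R\ge R_0$, the Hausdorff distance between $\overline{\Omega_n}\cap \overline{B_R(0)}$ and $\overline{\Omega_\infty}\cap \overline{B_R(0)}$ tends to $0$. **Line type.** Let $\Omega\subset\mathbb{C}^{d+1}$ be a convex domain with $C^\infty$ boundary and $\xi\in\partial\Omega$. After a complex affine change of coordinates, $\xi=0$, $\Omega\subset\{\operatorname{Im}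 z_0>0\}$, and near $0$ the domain is $\{(x+iy,z) : y>F(x,z)\}$ with $F$ real-valued and $C^\infty$. Put $f(z)=F(0,z)$; this function is convex and non-negative near $0\in\mathbb{C}^d$, and $f(0)=0$. For $v\in\mathbb{C}^d$ let $\operatorname{ord}(f;v)\in\mathbb{N}\cup\{\infty\}$ be the order of vanishing of $\zeta\mapsto f(\zeta v)$ at $\zeta=0\in\mathbb{C}$, and let $V_r=\{v : \operatorname{ord}(f;v)\ge r\}$, which is a complex linear subspace of $\mathbb{C}^d$. The line type of $\xi$ is the tuple $m(\xi)=(m_1,\dots,m_d)$ with $m_1\le\dots\le m_d$ in $\mathbb{N}\cup\{\infty\}$, where $m_j=\max\{r\in\mathbb{N}\cup\{\infty\} : \dim_{\mathbb{C}}V_r\ge d-j+1\}$. **Theorem.** Let $\Omega\subset\mathbb{C}^{d+1}$ be a bounded convex domain with $C^\infty$ boundary, and let $\xi\in\partial\Omega$ have finite line type $m(\xi)=(m_1,\dots,m_d)\in\mathbb{N}^d$. Then there exist points $x_n\in\Omega$ with $x_n\to\xi$ and complex affine automorphisms $A_n$ of $\mathbb{C}^{d+1}$ such that $$(A_n\Omega,\,A_nx_n)\longrightarrow(\widehat{\Omega},0)\quad\text{in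 }\mathbb{X}_{d+1,0},\qquad \widehat{\Omega}=\{(x+iy,z)\in\mathbb{C}\times\mathbb{C}^d : x<1-P(z)\},$$ where 1. $P:\mathbb{C}^d\to\mathbb{R}$ is a convex, non-negative polynomial (in the real and imaginary parts of the coordinates) with $P(0)=0$; 2. $P(t^{1/m_1}z_1,\dots,t^{1/m_d}z_d)=t\,P(z_1,\dots,z_d)$ for all $t>0$ and $(z_1,\dots,z_d)\in\mathbb{C}^d$; 3. $\mathbb{D}e_i\subset\widehat{\Omega}$ for all $0\le i\le d$; 4. $Z_i\cap\widehat{\Omega}=\emptyset$ for all $0\le i\le d$. -/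

import Mathlib

open Set Filter Topology
open scoped ContDiff

namespace RescaleConvex

/-- `ℂⁿ` with its Euclidean norm. -/
abbrev Cn (n : ℕ) : Type := EuclideanSpace ℂ (Fin n)

/-- For `w = (w₀, w₁, …, w_d) ∈ ℂ^{d+1} = ℂ × ℂ^d`, the component `(w₁, …, w_d) ∈ ℂ^d`. -/
noncomputable def tail {d : ℕ} (w : Cn (d + 1)) : Cn d :=
  WithLp.toLp 2 fun j : Fin d => w j.succ

/-! ### Convex domains and the local Hausdorff topology -/

/-- A convex domain: a non-empty open convex subset of `ℂⁿ` (connectedness is automatic). -/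
structure IsConvexDomain {n : ℕ} (Ω : Set (Cn n)) : Prop where
  isOpen : IsOpen Ω
  nonempty : Ω.Nonempty
  convex : Convex ℝ Ω

/-- The boundary of the open set `Ω` is `C^∞`: near every boundary point `Ω` is the sublevel set
`{ρ < 0}` of a real `C^∞` function with non-vanishing differential at that point. -/
def HasSmoothBoundary {n : ℕ} (Ω : Set (Cn n)) : Prop :=
  ∀ ξ ∈ frontier Ω, ∃ (U : Set (Cn n)) (ρ : Cn n → ℝ), IsOpen U ∧ ξ ∈ U ∧
    ContDiffOn ℝ ∞ ρ U ∧ fderiv ℝ ρ ξ ≠ 0 ∧ Ω ∩ U = {z | z ∈ U ∧ ρ z < 0}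

/-- `Ω` contains a complex affine line. -/
def ContainsComplexLine {n : ℕ} (Ω : Set (Cn n)) : Prop :=
  ∃ b a : Cn n, a ≠ 0 ∧ ∀ ζ : ℂ, b + ζ • a ∈ Ω

/-- The pair `(Ω, x)` belongs to `𝕏_{n,0}`: `Ω` is a convex domain in `ℂⁿ` without complex affine
lines and `x ∈ Ω`. -/
def MemX₀ {n : ℕ} (Ω : Set (Cn n)) (x : Cn n) : Prop :=
  IsConvexDomain Ω ∧ ¬ ContainsComplexLine Ω ∧ x ∈ Ω

/-- Convergence of open convex sets in the local Hausdorff topology: for all large `R`, the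
Hausdorff distance between `closure (Ωs k) ∩ B_R(0)` and `closure Ω ∩ B_R(0)` tends to `0`.
(The extended distance is used, so that the distance from the empty set to a non-empty set is `⊤`
and not `0`.) -/
def LocalHausdorffTendsto {n : ℕ} (Ωs : ℕ → Set (Cn n)) (Ω : Set (Cn n)) : Prop :=
  ∃ R₀ : ℝ, 0 ≤ R₀ ∧ ∀ R : ℝ, R₀ ≤ R →
    Tendsto (fun k => Metric.hausdorffEDist (closure (Ωs k) ∩ Metric.closedBall 0 R)
      (closure Ω ∩ Metric.closedBall 0 R)) atTop (𝓝 0)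

/-- `(Ωs k, xs k) → (Ω, x)` in `𝕏_{n,0}`. -/
structure TendstoX₀ {n : ℕ} (Ωs : ℕ → Set (Cn n)) (xs : ℕ → Cn n) (Ω : Set (Cn n)) (x : Cn n) :
    Prop where
  mem : ∀ k, MemX₀ (Ωs k) (xs k)
  mem_limit : MemX₀ Ω x
  tendsto_domain : LocalHausdorffTendsto Ωs Ω
  tendsto_point : Tendsto xs atTop (𝓝 x)

/-! ### Line type -/

/-- The order of vanishing at `0` of a function `g : ℂ → ℝ` that is `C^∞` near `0`: the supremum of
all `r ∈ ℕ ∪ {∞}` such that all real partial derivatives of `g` of order `< r` vanish at `0`. -/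
noncomputable def vanishingOrder (g : ℂ → ℝ) : ℕ∞ :=
  sSup {r : ℕ∞ | ∀ k : ℕ, (k : ℕ∞) < r → iteratedFDeriv ℝ k g 0 = 0}

/-- `ord(f; v)`: the order of vanishing at `ζ = 0` of `ζ ↦ f(ζ v)`. -/
noncomputable def ord {d : ℕ} (f : Cn d → ℝ) (v : Cn d) : ℕ∞ :=
  vanishingOrder fun ζ : ℂ => f (ζ • v)

/-- `V_r = {v : ord(f; v) ≥ r}`. For `f` convex and non-negative near `0` with `f(0) = 0` this set
is already a complex linear subspace, so that taking the span changes nothing. -/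
noncomputable def V {d : ℕ} (f : Cn d → ℝ) (r : ℕ∞) : Submodule ℂ (Cn d) :=
  Submodule.span ℂ {v | r ≤ ord f v}

/-- The type `m₁ ≤ m₂ ≤ … ≤ m_d` of `f` at `0`: the values of `ord(f; ·)` on `ℂ^d ∖ {0}`, in
increasing order, a value `r` being repeated `dim V_r - dim V_{r+1}` times (`dim V_∞` times for
`r = ∞`). Equivalently, `m_j` is the largest `r` such that `dim V_r ≥ d - j + 1`; the index `j` of
the code starts at `0`. -/
noncomputable def typeAtZero {d : ℕ} (f : Cn d → ℝ) (j : Fin d) : ℕ∞ :=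
  sSup {r : ℕ∞ | d - (j : ℕ) ≤ Module.finrank ℂ (V f r)}

/-- `m` is the line type of the convex domain `Ω ⊆ ℂ^{d+1}` at `ξ ∈ ∂Ω`. A complex affine
automorphism `A` moves `ξ` to `0` and `Ω` into `{Im w₀ > 0}`; near `0` the domain `A(Ω)` is the
region `{(x + iy, z) : y > F(x, z)}` above the graph of a `C^∞` function `F`; and `m` is the type at
`0` of `z ↦ F(0, z)`. (As `A(Ω)` lies in `{Im w₀ > 0}` and `0` is in its boundary, `F ≥ 0` and
`F(0, 0) = 0`, so the tangent space of the boundary at `0` is `ℝ × ℂ^d`.) -/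
def HasLineType {d : ℕ} (Ω : Set (Cn (d + 1))) (ξ : Cn (d + 1)) (m : Fin d → ℕ∞) : Prop :=
  ∃ (A : Cn (d + 1) ≃ᵃ[ℂ] Cn (d + 1)) (U V : Set ℝ) (W : Set (Cn d)) (F : ℝ × Cn d → ℝ),
    A ξ = 0 ∧ A '' Ω ⊆ {w | 0 < (w 0).im} ∧
    IsOpen U ∧ (0 : ℝ) ∈ U ∧ IsOpen V ∧ (0 : ℝ) ∈ V ∧ IsOpen W ∧ (0 : Cn d) ∈ W ∧
    ContDiffOn ℝ ∞ F (U ×ˢ W) ∧ MapsTo F (U ×ˢ W) V ∧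
    A '' Ω ∩ {w | (w 0).re ∈ U ∧ (w 0).im ∈ V ∧ tail w ∈ W} =
      {w | (w 0).re ∈ U ∧ (w 0).im ∈ V ∧ tail w ∈ W ∧ F ((w 0).re, tail w) < (w 0).im} ∧
    m = typeAtZero fun z => F (0, z)

/-! ### The normalized polynomial domains -/

/-- `P : ℂ^d → ℝ` is a real polynomial in the real and imaginary parts of the coordinates
(equivalently, a real-valued polynomial in `z` and `z̄`). -/
def IsRealPolynomial {d : ℕ} (P : Cn d → ℝ) : Prop :=
  ∃ p : MvPolynomial (Fin d ⊕ Fin d) ℝ, ∀ z : Cn d,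
    P z = MvPolynomial.eval (Sum.elim (fun j => (z j).re) (fun j => (z j).im)) p

/-- `P(t^{1/m₁} z₁, …, t^{1/m_d} z_d) = t P(z₁, …, z_d)` for all `t > 0`, `z ∈ ℂ^d`. -/
def IsWeightedHomogeneous {d : ℕ} (m : Fin d → ℕ) (P : Cn d → ℝ) : Prop :=
  ∀ t : ℝ, 0 < t → ∀ z : Cn d,
    P (WithLp.toLp 2 fun j => ((t ^ (1 / (m j : ℝ)) : ℝ) : ℂ) * z j) = t * P z

/-- `{(x + iy, z) ∈ ℂ × ℂ^d : x < 1 - P(z)}`. -/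
def polyDomain {d : ℕ} (P : Cn d → ℝ) : Set (Cn (d + 1)) :=
  {w | (w 0).re < 1 - P (tail w)}

/-- The open unit disk `𝔻 e_i` in the `i`-th coordinate line. -/
def unitDisk {n : ℕ} (i : Fin n) : Set (Cn n) :=
  {w | ∃ ζ : ℂ, ‖ζ‖ < 1 ∧ w = EuclideanSpace.single i ζ}

/-- The complex plane `Z_i = e_i + span_ℂ {e_j : j > i}`. -/
def planeZ {n : ℕ} (i : Fin n) : Set (Cn n) :=
  {w | (∀ j, j < i → w j = 0) ∧ w i = 1}

end RescaleConvex

/-! Move ξ to 0, so that near 0 the domain is Im z₀ > F(Re z₀, z), and put f = F(0, ·). Convexity of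
the domain makes f convex near 0. Since F ≥ 0 = F(0, 0) near 0, the differential of F vanishes
there. For s → 0+ pull the domain back by Φ_s(w) = (is(1 - w₀), L δ_s z), where z is the tail of w,
δ_s multiplies z_j by s^(1/m_j), and L is linear with L e_j = ξ_j. On a fixed ball, for small s, the
pullback is s⁻¹ F(s Im w₀, L δ_s z) + Re w₀ < 1. Replacing s Im w₀ by 0 changes F by o(s), so
everything rests on the limit of s⁻¹ f(L δ_s z).

If f has order at least m_j along ξ_j, Jensen's inequality bounds f(L δ_s z) by the mean of the f(d
s^(1/m_j) z_j ξ_j), which is O(s). So in the Taylor polynomial of f ∘ L, with z_j of weight 1/m_j,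
the part of weight < 1 vanishes. A Taylor remainder O(‖z‖^N) with N > m_j for all j is o(s). The
limit is therefore the part P of weight 1, and it inherits convexity and non-negativity
(`tendsto_modelPart`).

The frame normalizes P. In a flag W_0 = ℂ^d ⊇ W_1 ⊇ …, with f of order at least m_j on W_j, let h_j
be the part of degree m_j of f, take ξ_j nearest to 0 in {h_j ≥ 1} ∩ W_j, and put W_{j+1} = ξ_j^⊥ ∩
W_j. Convexity gives h_j ≥ 1 on ξ_j + W_{j+1} (`exists_nearest_point`), and this forces every vector
of order > m_j into W_{j+1}, so that the construction continues (`exists_next_orderFlag`). On a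
block of equal weights P equals h_j ∘ L, hence P(ζ e_j) < 1 for |ζ| < 1. If z starts with zeros and
then z_j = 1, dropping the coordinates of smaller weight does not increase P
(`modelPart_truncate_le`), hence P(z) ≥ 1. This bound also excludes complex lines from the limit
domain. -/

open Asymptotics

namespace RescaleConvex

universe u

/-! ### Taylor estimates at a point -/

/-- A function whose derivatives of order `< N` vanish at `0` is `O(‖x‖ ^ N)`. -/
theorem isBigO_pow_of_iteratedFDeriv_eq_zero {E : Type u} [NormedAddCommGroup E] [NormedSpace ℝ E]
    (N : ℕ) : ∀ {F : Type u} [NormedAddCommGroup F] [NormedSpace ℝ F] {G : E → F},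
    ContDiffAt ℝ N G 0 → (∀ k < N, iteratedFDeriv ℝ k G 0 = 0) →
    G =O[𝓝 0] fun x => ‖x‖ ^ N := by
  induction N with
  | zero =>
    intro F _ _ G hG _
    simpa using hG.continuousAt.isBigO_one ℝ
  | succ N ih =>
    intro F _ _ G hG h
    have hG0 : G 0 = 0 := by
      have := h 0 (Nat.succ_pos _)
      rw [← norm_eq_zero, norm_iteratedFDeriv_zero] at this
      exact norm_eq_zero.1 this
    -- The induction hypothesis is used for `fderiv ℝ G`, which has another target space: hence the
    -- quantifier over `F` inside the induction.
    have h1 : (fderiv ℝ G) =O[𝓝 0] fun x => ‖x‖ ^ N := by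
      refine ih (hG.fderiv_right (by norm_cast)) fun k hk => ?_
      rw [← norm_eq_zero, norm_iteratedFDeriv_fderiv, h (k + 1) (by lia), norm_zero]
    obtain ⟨C, hC⟩ := h1.bound
    have h2 : ∀ᶠ x in 𝓝 (0 : E), DifferentiableAt ℝ G x :=
      (hG.eventually (by exact_mod_cast WithTop.coe_ne_top)).mono fun x hx =>
        hx.differentiableAt (by norm_cast)
    obtain ⟨ε, hε, hb⟩ := Metric.eventually_nhds_iff_ball.1 (hC.and h2)
    refine IsBigO.of_bound C ?_
    filter_upwards [Metric.ball_mem_nhds (0 : E) hε] with x hx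
    have hsub : ∀ y ∈ Metric.closedBall (0 : E) ‖x‖, y ∈ Metric.ball (0 : E) ε := by
      intro y hy
      simp only [Metric.mem_closedBall, Metric.mem_ball, dist_zero_right] at *
      exact hy.trans_lt hx
    have hCx : 0 ≤ C ∨ x = 0 := by
      by_cases hx0 : x = 0
      · exact Or.inr hx0
      · refine Or.inl ?_
        have := (norm_nonneg _).trans (hb x hx).1
        rw [norm_pow, norm_norm] at this
        exact nonneg_of_mul_nonneg_left this (by positivity)
    rcases hCx with hC0 | rfl
    · have := (convex_closedBall (0 : E) ‖x‖).norm_image_sub_le_of_norm_fderiv_le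
        (f := G) (C := C * ‖x‖ ^ N) (𝕜 := ℝ) (x := 0) (y := x)
        (fun y hy => (hb y (hsub y hy)).2) (fun y hy => ?_) (by simp) (by simp)
      · simpa [hG0, pow_succ, mul_assoc] using this
      · refine (hb y (hsub y hy)).1.trans ?_
        rw [norm_pow, norm_norm]
        have : ‖y‖ ≤ ‖x‖ := by simpa using hy
        gcongr
    · simp [hG0]

/-- An interpolation inequality of Landau type at a point. -/
theorem isLittleO_fderiv_of_isLittleO {E F : Type u} [NormedAddCommGroup E] [NormedSpace ℝ E]
    [NormedAddCommGroup F] [NormedSpace ℝ F] {G : E → F} {n : ℕ} (hG : ContDiffAt ℝ ∞ G 0)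
    (h0 : G =o[𝓝 0] fun x => ‖x‖ ^ (n + 2))
    (h2 : fderiv ℝ (fderiv ℝ G) =O[𝓝 0] fun x => ‖x‖ ^ n) :
    fderiv ℝ G =o[𝓝 0] fun x => ‖x‖ ^ (n + 1) := by
  have hG2 : ContDiffAt ℝ 2 G 0 := by exact_mod_cast contDiffAt_infty.1 hG 2
  have hd1 : ∀ᶠ x in 𝓝 (0 : E), DifferentiableAt ℝ G x :=
    (hG2.eventually (by norm_num)).mono fun x hx => hx.differentiableAt (by norm_num)
  have hd2 : ∀ᶠ x in 𝓝 (0 : E), DifferentiableAt ℝ (fderiv ℝ G) x :=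
    (hG2.eventually (by norm_num)).mono fun x hx =>
      (hx.fderiv_right (m := 1) (by norm_num)).differentiableAt (by norm_num)
  have hG0 : G 0 = 0 := by
    obtain ⟨c, hc⟩ := h0.isBigO.bound
    simpa using hc.self_of_nhds
  have hD0 : fderiv ℝ G 0 = 0 := by
    have : HasFDerivAt G (0 : E →L[ℝ] F) 0 := by
      rw [hasFDerivAt_iff_isLittleO_nhds_zero]
      simp only [zero_add, hG0, sub_zero, zero_apply]
      refine h0.trans_isBigO ?_
      refine IsBigO.of_bound 1 ?_
      filter_upwards [Metric.ball_mem_nhds (0 : E) one_pos] with x hx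
      have hx1 : ‖x‖ ≤ 1 := (mem_ball_zero_iff.1 hx).le
      rw [norm_pow, norm_norm, one_mul, pow_succ]
      exact mul_le_of_le_one_left (norm_nonneg _) (pow_le_one₀ (norm_nonneg _) hx1)
    exact this.fderiv
  obtain ⟨C, hCpos, hC⟩ := h2.exists_pos
  rw [isLittleO_iff]
  intro ε hε
  -- Compare G at x and at y = x + δ‖x‖w with ‖w‖ = 1: δ‖x‖·‖DG(x)w‖ ≤ ‖G y‖ + ‖G x‖ + C(2‖x‖)^n
  -- (δ‖x‖)². Here δ makes the quadratic term account for ε/2, and η, chosen after δ, makes the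
  -- values of G account for the other half. As δ ≤ 1, all points used have norm at most 2‖x‖.
  set δ : ℝ := min 1 (ε / (2 * (C * 2 ^ n))) with hδ
  have hδ0 : 0 < δ := by positivity
  have hδ1 : δ ≤ 1 := min_le_left _ _
  have hδC : C * 2 ^ n * δ ≤ ε / 2 := by
    have : δ ≤ ε / (2 * (C * 2 ^ n)) := min_le_right _ _
    rw [le_div_iff₀ (by positivity)] at this
    linarith
  set η : ℝ := ε * δ / (2 * (1 + 2 ^ (n + 2))) with hη
  have hη0 : 0 < η := by positivity
  have hηe : η * (1 + 2 ^ (n + 2)) = ε / 2 * δ := by rw [hη]; field_simp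
  obtain ⟨ρ, hρ, hb⟩ := Metric.eventually_nhds_iff_ball.1
    (((isLittleO_iff.1 h0 hη0).and hC.bound).and (hd1.and hd2))
  filter_upwards [Metric.ball_mem_nhds (0 : E) (half_pos hρ)] with x hx
  by_cases hx0 : x = 0
  · simp [hx0, hD0]
  have hxn : 0 < ‖x‖ := norm_pos_iff.2 hx0
  have hxρ : ‖x‖ < ρ / 2 := by simpa using hx
  rw [norm_pow, norm_norm]
  have hball : ∀ y, ‖y - x‖ ≤ δ * ‖x‖ → ‖y‖ ≤ 2 * ‖x‖ ∧ y ∈ Metric.ball (0 : E) ρ := by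
    intro y hy
    have h1 : ‖y‖ ≤ ‖y - x‖ + ‖x‖ := by simpa using norm_add_le (y - x) x
    have h3 : δ * ‖x‖ ≤ ‖x‖ := mul_le_of_le_one_left hxn.le hδ1
    have h4 : ‖y‖ ≤ 2 * ‖x‖ := by linarith
    exact ⟨h4, by simpa using (by linarith : ‖y‖ < ρ)⟩
  have hB1 : ∀ y ∈ Metric.closedBall x (δ * ‖x‖),
      ‖fderiv ℝ G y - fderiv ℝ G x‖ ≤ C * (2 * ‖x‖) ^ n * (δ * ‖x‖) := by
    intro y hy
    have hy' : ‖y - x‖ ≤ δ * ‖x‖ := by simpa [dist_eq_norm] using hy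
    refine ((convex_closedBall x (δ * ‖x‖)).norm_image_sub_le_of_norm_fderiv_le (𝕜 := ℝ)
      (C := C * (2 * ‖x‖) ^ n) (fun z hz => ?_) (fun z hz => ?_) ?_ hy).trans ?_
    · exact (hb z (hball z (by simpa [dist_eq_norm] using hz)).2).2.2
    · have hz' := hball z (by simpa [dist_eq_norm] using hz)
      refine (hb z hz'.2).1.2.trans ?_
      rw [norm_pow, norm_norm]
      have := hz'.1
      gcongr
    · simpa using by positivity
    · gcongr
  refine ContinuousLinearMap.opNorm_le_of_unit_norm (by positivity) fun w hw => ?_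
  have hyx : ‖(x + (δ * ‖x‖) • w) - x‖ ≤ δ * ‖x‖ := by
    rw [add_sub_cancel_left, norm_smul, hw, mul_one, Real.norm_of_nonneg (by positivity)]
  have hB2 := (convex_closedBall x (δ * ‖x‖)).norm_image_sub_le_of_norm_fderiv_le' (𝕜 := ℝ)
      (f := G) (φ := fderiv ℝ G x) (x := x) (y := x + (δ * ‖x‖) • w)
      (fun z hz => (hb z (hball z (by simpa [dist_eq_norm] using hz)).2).2.1) hB1
      (by simpa using by positivity) (by simpa [dist_eq_norm] using hyx)
  have hGx : ‖G x‖ ≤ η * ‖x‖ ^ (n + 2) := by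
    have := (hb x (hball x (by simpa using by positivity)).2).1.1
    rwa [norm_pow, norm_norm] at this
  have hGy : ‖G (x + (δ * ‖x‖) • w)‖ ≤ η * (2 * ‖x‖) ^ (n + 2) := by
    obtain ⟨h3, h4⟩ := hball _ hyx
    refine ((hb _ h4).1.1).trans ?_
    rw [norm_pow, norm_norm]
    gcongr
  rw [add_sub_cancel_left] at hB2 hyx
  set y := x + (δ * ‖x‖) • w
  have hkey : ‖fderiv ℝ G x ((δ * ‖x‖) • w)‖ ≤
      η * (2 * ‖x‖) ^ (n + 2) + η * ‖x‖ ^ (n + 2)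
        + C * (2 * ‖x‖) ^ n * (δ * ‖x‖) * (δ * ‖x‖) := by
    have e : fderiv ℝ G x ((δ * ‖x‖) • w) =
        G y - G x - (G y - G x - fderiv ℝ G x ((δ * ‖x‖) • w)) := by abel
    rw [e]
    refine (norm_sub_le _ _).trans (add_le_add ((norm_sub_le _ _).trans (add_le_add hGy hGx)) ?_)
    refine hB2.trans ?_
    gcongr
  rw [map_smul, norm_smul, Real.norm_of_nonneg (by positivity : 0 ≤ δ * ‖x‖)] at hkey
  have e1 : η * (2 * ‖x‖) ^ (n + 2) + η * ‖x‖ ^ (n + 2)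
      + C * (2 * ‖x‖) ^ n * (δ * ‖x‖) * (δ * ‖x‖)
      = (δ * ‖x‖) * (ε / 2 * ‖x‖ ^ (n + 1) + C * 2 ^ n * δ * ‖x‖ ^ (n + 1)) := by
    have : η * (2 * ‖x‖) ^ (n + 2) + η * ‖x‖ ^ (n + 2)
        = (η * (1 + 2 ^ (n + 2))) * ‖x‖ ^ (n + 2) := by rw [mul_pow]; ring
    rw [this, hηe, mul_pow]
    ring
  rw [e1] at hkey
  have h5 := le_of_mul_le_mul_left hkey (by positivity)
  have h6 : C * 2 ^ n * δ * ‖x‖ ^ (n + 1) ≤ ε / 2 * ‖x‖ ^ (n + 1) := by gcongr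
  linarith

/-- If the derivatives of order `< r` of `G` vanish at `0` and `G = o(‖x‖ ^ r)`, then the
derivative of order `r` vanishes as well. -/
theorem iteratedFDeriv_eq_zero_of_isLittleO {E : Type u} [NormedAddCommGroup E] [NormedSpace ℝ E]
    (r : ℕ) : ∀ {F : Type u} [NormedAddCommGroup F] [NormedSpace ℝ F] {G : E → F},
    ContDiffAt ℝ ∞ G 0 → (∀ k < r, iteratedFDeriv ℝ k G 0 = 0) →
    (G =o[𝓝 0] fun x => ‖x‖ ^ r) → iteratedFDeriv ℝ r G 0 = 0 := by
  induction r with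
  | zero =>
    intro F _ _ G hG _ h
    rw [← norm_eq_zero, norm_iteratedFDeriv_zero, norm_eq_zero]
    simp only [pow_zero, isLittleO_one_iff] at h
    exact tendsto_nhds_unique hG.continuousAt h
  | succ r ih =>
    intro F _ _ G hG h ho
    have hG' : ContDiffAt ℝ ∞ (fderiv ℝ G) 0 := hG.fderiv_right (by simp)
    have hG0 : G 0 = 0 := by
      have := h 0 (Nat.succ_pos _)
      rw [← norm_eq_zero, norm_iteratedFDeriv_zero] at this
      exact norm_eq_zero.1 this
    have hk : ∀ k < r, iteratedFDeriv ℝ k (fderiv ℝ G) 0 = 0 := fun k hk => by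
      rw [← norm_eq_zero, norm_iteratedFDeriv_fderiv, h (k + 1) (by lia), norm_zero]
    rw [← norm_eq_zero, ← norm_iteratedFDeriv_fderiv, norm_eq_zero]
    refine ih hG' hk ?_
    -- At first order, G = o(‖x‖) says directly that DG(0) = 0. At higher order the interpolation
    -- inequality applies, the bound on D²G coming from the vanishing derivatives.
    rcases r with _ | n
    · have hD : HasFDerivAt G (0 : E →L[ℝ] F) 0 := by
        rw [hasFDerivAt_iff_isLittleO_nhds_zero]
        simp only [zero_add, hG0, sub_zero, zero_apply]
        simpa using (show G =o[𝓝 0] fun x : E => ‖x‖ by simpa using ho).of_norm_right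
      simp only [pow_zero, isLittleO_one_iff]
      rw [← hD.fderiv]
      exact hG'.continuousAt
    · refine isLittleO_fderiv_of_isLittleO hG ho ?_
      refine isBigO_pow_of_iteratedFDeriv_eq_zero n
        (contDiffAt_infty.1 (hG'.fderiv_right (m := ∞) (by simp)) n) fun k hkn => ?_
      rw [← norm_eq_zero, norm_iteratedFDeriv_fderiv, hk (k + 1) (by lia), norm_zero]

/-- Dividing each coefficient by the degree of its monomial plus one gives s L(sx) = ∫₀ˢ p(tx) dt.
This integrates Taylor polynomials of partial derivatives along rays. -/
theorem exists_radial_antiderivative {ι : Type*} (p : MvPolynomial ι ℝ) :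
    ∃ L : MvPolynomial ι ℝ, ∀ (x : ι → ℝ) (s : ℝ),
      HasDerivAt (fun s => s * MvPolynomial.eval (fun i => s * x i) L)
        (MvPolynomial.eval (fun i => s * x i) p) s := by
  induction p using MvPolynomial.induction_on' with
  | monomial α a =>
    refine ⟨MvPolynomial.monomial α (a / (α.degree + 1)), fun x s => ?_⟩
    have key : ∀ (b s : ℝ), MvPolynomial.eval (fun i => s * x i) (MvPolynomial.monomial α b) =
        s ^ α.degree * MvPolynomial.eval x (MvPolynomial.monomial α b) := by
      intro b s
      simp only [MvPolynomial.eval_monomial, Finsupp.prod, mul_pow, Finset.prod_mul_distrib,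
        Finset.prod_pow_eq_pow_sum, Finsupp.degree_apply]
      ring
    simp only [key]
    have h1 := (hasDerivAt_pow (α.degree + 1) s).mul_const
      (MvPolynomial.eval x (MvPolynomial.monomial α (a / (α.degree + 1))))
    convert! h1 using 1
    · funext t; ring
    · simp only [MvPolynomial.eval_monomial]
      push_cast
      have : (α.degree : ℝ) + 1 ≠ 0 := by positivity
      field_simp
  | add p q hp hq =>
    obtain ⟨L, hL⟩ := hp
    obtain ⟨L', hL'⟩ := hq
    refine ⟨L + L', fun x s => ?_⟩
    simp only [map_add, mul_add]
    exact (hL x s).add (hL' x s)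

/-- Taylor's theorem: a `C^N` function agrees with a polynomial up to `O(‖x‖ ^ N)`. -/
theorem exists_taylor_polynomial {E : Type*} [NormedAddCommGroup E] [NormedSpace ℝ E]
    {ι : Type*} [Fintype ι] (c : ι → E →L[ℝ] ℝ) (e : ι → E) (hce : ∀ x, ∑ i, c i x • e i = x)
    (N : ℕ) : ∀ f : E → ℝ, ContDiffAt ℝ N f 0 → ∃ p : MvPolynomial ι ℝ,
      (fun x => f x - MvPolynomial.eval (fun i => c i x) p) =O[𝓝 0] fun x => ‖x‖ ^ N := by
  induction N with
  | zero =>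
    intro f hf
    exact ⟨0, by simpa using hf.continuousAt.isBigO_one ℝ⟩
  | succ N ih =>
    intro f hf
    have h1 : ∀ i, ContDiffAt ℝ N (fun x => fderiv ℝ f x (e i)) 0 := fun i =>
      (hf.fderiv_right (m := N) (by norm_cast)).clm_apply contDiffAt_const
    choose p hp using fun i => ih _ (h1 i)
    choose L hL using fun i => exists_radial_antiderivative (p i)
    choose C hC0 hC using fun i => (hp i).exists_pos
    have hC' := fun i => (hC i).bound
    have h2 : ∀ᶠ x in 𝓝 (0 : E), DifferentiableAt ℝ f x :=
      (hf.eventually (by exact_mod_cast WithTop.coe_ne_top)).mono fun x hx =>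
        hx.differentiableAt (by norm_cast)
    obtain ⟨ε, hε, hb⟩ := Metric.eventually_nhds_iff_ball.1 ((eventually_all.2 hC').and h2)
    -- This is f(x) = f(0) + ∑ xᵢ ∫₀¹ ∂ᵢf(sx) ds with ∂ᵢf replaced by its polynomial `p i`, at a
    -- cost of O(‖x‖^N) each.
    refine ⟨MvPolynomial.C (f 0) + ∑ i, MvPolynomial.X i * L i,
      IsBigO.of_bound (∑ i, ‖c i‖ * C i) ?_⟩
    filter_upwards [Metric.ball_mem_nhds (0 : E) hε] with x hx
    have hxs : ∀ s ∈ Icc (0 : ℝ) 1, s • x ∈ Metric.ball (0 : E) ε ∧ ‖s • x‖ ≤ ‖x‖ := by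
      intro s hs
      have : ‖s • x‖ ≤ ‖x‖ := by
        rw [norm_smul, Real.norm_of_nonneg hs.1]
        exact mul_le_of_le_one_left (norm_nonneg _) hs.2
      exact ⟨by simpa using this.trans_lt (by simpa using hx), this⟩
    have hder : ∀ s ∈ Icc (0 : ℝ) 1, HasDerivWithinAt (fun s : ℝ => f (s • x) -
        ∑ i, c i x * (s * MvPolynomial.eval (fun j => s * c j x) (L i)))
        (∑ i, c i x * (fderiv ℝ f (s • x) (e i) -
          MvPolynomial.eval (fun j => c j (s • x)) (p i))) (Icc 0 1) s := by
      intro s hs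
      have hd := (hb _ (hxs s hs).1).2.hasFDerivAt
      have hl : HasDerivAt (fun s : ℝ => s • x) x s := by
        simpa using (hasDerivAt_id s).smul_const x
      have h3 := hd.comp_hasDerivAt s hl
      have h4 : fderiv ℝ f (s • x) x = ∑ i, c i x * fderiv ℝ f (s • x) (e i) := by
        conv_lhs => rw [congrArg (fderiv ℝ f (s • x)) (hce x).symm]
        simp only [map_sum, map_smul, smul_eq_mul]
      rw [h4] at h3
      have h5 := HasDerivAt.fun_sum (u := Finset.univ)
        (fun i _ => (hL i (fun j => c j x) s).const_mul (c i x))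
      convert! (h3.sub h5).hasDerivWithinAt using 1
      simp [mul_sub, Finset.sum_sub_distrib]
    have hm := norm_image_sub_le_of_norm_deriv_le_segment_01' (C := (∑ i, ‖c i‖ * C i) * ‖x‖ ^ (N + 1))
      hder (fun s hs => ?_)
    · simp only [one_smul, one_mul, zero_smul, zero_mul, mul_zero, Finset.sum_const_zero,
        sub_zero] at hm
      rw [norm_pow, norm_norm]
      convert! hm using 2
      simp
      ring
    · rw [Finset.sum_mul]
      refine norm_sum_le_of_le _ fun i _ => ?_
      obtain ⟨h6, h7⟩ := hxs s (Ico_subset_Icc_self hs)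
      have h8 := (hb _ h6).1 i
      rw [norm_mul]
      calc _ ≤ (‖c i‖ * ‖x‖) * (C i * ‖x‖ ^ N) := by
            gcongr
            · exact (c i).le_opNorm x
            · refine h8.trans ?_
              rw [norm_pow, norm_norm]
              have := (hC0 i).le
              gcongr
        _ = _ := by ring

/-! ### Weighted components of a polynomial under anisotropic dilations -/

section Weights

variable {ι : Type*} [Fintype ι]

/-- The weight `∑ wᵢ αᵢ` of the monomial `x ^ α`. -/
def weight (w : ι → ℝ) (α : ι →₀ ℕ) : ℝ := ∑ i, w i * α i

/-- The part of weight `κ` of a polynomial. -/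
noncomputable def weightComponent (w : ι → ℝ) (κ : ℝ) (p : MvPolynomial ι ℝ) : MvPolynomial ι ℝ :=
  ∑ α ∈ p.support with weight w α = κ, MvPolynomial.monomial α (p.coeff α)

/-- The anisotropic dilation `xᵢ ↦ s ^ wᵢ xᵢ`. -/
noncomputable def dilate (w : ι → ℝ) (s : ℝ) (x : ι → ℝ) : ι → ℝ := fun i => s ^ w i * x i

theorem eval_weightComponent (w : ι → ℝ) (κ : ℝ) (p : MvPolynomial ι ℝ) (x : ι → ℝ) :
    MvPolynomial.eval x (weightComponent w κ p) =
      ∑ α ∈ p.support with weight w α = κ, p.coeff α * ∏ i, x i ^ α i := by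
  simp [weightComponent, map_sum, MvPolynomial.eval_monomial, Finsupp.prod_fintype]

theorem prod_dilate_pow (w : ι → ℝ) {s : ℝ} (hs : 0 < s) (x : ι → ℝ) (α : ι →₀ ℕ) :
    ∏ i, dilate w s x i ^ α i = s ^ weight w α * ∏ i, x i ^ α i := by
  simp only [dilate, mul_pow, Finset.prod_mul_distrib, weight]
  rw [Real.rpow_sum_of_pos hs]
  congr 1
  refine Finset.prod_congr rfl fun i _ => ?_
  rw [Real.rpow_mul hs.le, Real.rpow_natCast]

theorem eval_dilate_weightComponent (w : ι → ℝ) (κ : ℝ) (p : MvPolynomial ι ℝ) {s : ℝ}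
    (hs : 0 < s) (x : ι → ℝ) :
    MvPolynomial.eval (dilate w s x) (weightComponent w κ p) =
      s ^ κ * MvPolynomial.eval x (weightComponent w κ p) := by
  rw [eval_weightComponent, eval_weightComponent, Finset.mul_sum]
  refine Finset.sum_congr rfl fun α hα => ?_
  rw [prod_dilate_pow w hs, (Finset.mem_filter.1 hα).2]
  ring

/-- The weights of the monomials of a polynomial. -/
noncomputable def weights (w : ι → ℝ) (p : MvPolynomial ι ℝ) : Finset ℝ :=
  p.support.image (weight w)

theorem eval_dilate (w : ι → ℝ) (p : MvPolynomial ι ℝ) {s : ℝ} (hs : 0 < s) (x : ι → ℝ) :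
    MvPolynomial.eval (dilate w s x) p =
      ∑ l ∈ weights w p, s ^ l * MvPolynomial.eval x (weightComponent w l p) := by
  classical
  rw [MvPolynomial.eval_eq', weights, ← Finset.sum_fiberwise_of_maps_to
    (fun α hα => Finset.mem_image_of_mem (weight w) hα)]
  refine Finset.sum_congr rfl fun l _ => ?_
  rw [eval_weightComponent, Finset.mul_sum]
  refine Finset.sum_congr rfl fun α hα => ?_
  rw [prod_dilate_pow w hs, (Finset.mem_filter.1 hα).2]
  ring

theorem tendsto_rpow_nhdsGT_zero {a : ℝ} (ha : 0 < a) :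
    Tendsto (fun s : ℝ => s ^ a) (𝓝[>] 0) (𝓝 0) := by
  have := (Real.continuousAt_rpow_const 0 a (Or.inr ha.le)).tendsto
  rw [Real.zero_rpow ha.ne'] at this
  exact this.mono_left nhdsWithin_le_nhds

/-- A generalized polynomial that is `O(s ^ κ)` as `s → 0+` has no terms of exponent `< κ`. -/
theorem coeff_eq_zero_of_isBigO_rpow {Λ : Finset ℝ} {a : ℝ → ℝ} {κ : ℝ}
    (h : (fun s : ℝ => ∑ l ∈ Λ, s ^ l * a l) =O[𝓝[>] 0] fun s => s ^ κ) :
    ∀ l ∈ Λ, l < κ → a l = 0 := by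
  classical
  by_contra! hne
  obtain ⟨l₁, hl₁, hl₁κ, hal₁⟩ := hne
  -- After division by s^l₀, with l₀ the least exponent whose coefficient is nonzero, the sum tends
  -- to that coefficient; the bound O(s^(κ - l₀)) makes it tend to 0.
  obtain ⟨l₀, hl₀, hmin⟩ := Finset.exists_min_image (Λ.filter fun l => a l ≠ 0) id
    ⟨l₁, by simp [hl₁, hal₁]⟩
  simp only [Finset.mem_filter, id] at hl₀ hmin
  have hl₀κ : l₀ < κ := (hmin l₁ ⟨hl₁, hal₁⟩).trans_lt hl₁κ
  have h1 : Tendsto (fun s : ℝ => ∑ l ∈ Λ, s ^ (l - l₀) * a l) (𝓝[>] 0)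
      (𝓝 (∑ l ∈ Λ, if l = l₀ then a l else 0)) := by
    refine tendsto_finsetSum _ fun l hl => ?_
    split_ifs with h2
    · simp [h2]
    · by_cases h3 : a l = 0
      · simp [h3]
      · have : l₀ < l := lt_of_le_of_ne (hmin l ⟨hl, h3⟩) (Ne.symm h2)
        simpa using (tendsto_rpow_nhdsGT_zero (sub_pos.2 this)).mul_const (a l)
  have h2 : Tendsto (fun s : ℝ => ∑ l ∈ Λ, s ^ (l - l₀) * a l) (𝓝[>] 0) (𝓝 0) := by
    have h3 : (fun s : ℝ => s ^ (-l₀) * ∑ l ∈ Λ, s ^ l * a l) =O[𝓝[>] 0]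
        fun s => s ^ (-l₀) * s ^ κ := (isBigO_refl _ _).mul h
    refine (h3.congr' ?_ ?_).trans_tendsto (tendsto_rpow_nhdsGT_zero (sub_pos.2 hl₀κ))
    · filter_upwards [self_mem_nhdsWithin] with s hs
      rw [Finset.mul_sum]
      refine Finset.sum_congr rfl fun l _ => ?_
      rw [← mul_assoc, ← Real.rpow_add hs]
      ring_nf
    · filter_upwards [self_mem_nhdsWithin] with s hs
      rw [← Real.rpow_add hs]
      ring_nf
  have := tendsto_nhds_unique h1 h2
  simp [hl₀.1] at this
  exact hl₀.2 this

theorem eval_weightComponent_of_notMem {w : ι → ℝ} {p : MvPolynomial ι ℝ} {l : ℝ}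
    (hl : l ∉ weights w p) (x : ι → ℝ) :
    MvPolynomial.eval x (weightComponent w l p) = 0 := by
  rw [eval_weightComponent]
  refine Finset.sum_eq_zero fun α hα => ?_
  rw [Finset.mem_filter] at hα
  exact absurd (Finset.mem_image.2 ⟨α, hα⟩) hl

/-- Along the orbit of x the polynomial is a sum of powers of s whose coefficients are its
components at x, so growth along this one orbit decides the matter at x. -/
theorem eval_weightComponent_eq_zero {w : ι → ℝ} {p : MvPolynomial ι ℝ} {κ : ℝ} {x : ι → ℝ}
    (h : (fun s : ℝ => MvPolynomial.eval (dilate w s x) p) =O[𝓝[>] 0] fun s => s ^ κ)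
    {l : ℝ} (hl : l < κ) : MvPolynomial.eval x (weightComponent w l p) = 0 := by
  by_cases hm : l ∈ weights w p
  · refine coeff_eq_zero_of_isBigO_rpow
      (a := fun l => MvPolynomial.eval x (weightComponent w l p)) (h.congr' ?_ EventuallyEq.rfl)
      l hm hl
    filter_upwards [self_mem_nhdsWithin] with s hs
    exact eval_dilate w p hs x
  · exact eval_weightComponent_of_notMem hm x

/-- If the components of weight `< κ` vanish, rescaling converges to the component of weight
`κ`. -/
theorem tendsto_eval_dilate {T : Type*} {l : Filter T} {w : ι → ℝ} {p : MvPolynomial ι ℝ} {κ : ℝ}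
    {s : T → ℝ} {x : T → ι → ℝ} {x₀ : ι → ℝ} (hs : Tendsto s l (𝓝[>] 0))
    (hx : Tendsto x l (𝓝 x₀))
    (h0 : ∀ t, ∀ k < κ, MvPolynomial.eval (x t) (weightComponent w k p) = 0) :
    Tendsto (fun t => s t ^ (-κ) * MvPolynomial.eval (dilate w (s t) (x t)) p) l
      (𝓝 (MvPolynomial.eval x₀ (weightComponent w κ p))) := by
  classical
  have hc : ∀ q : MvPolynomial ι ℝ, Tendsto (fun t => MvPolynomial.eval (x t) q) l
      (𝓝 (MvPolynomial.eval x₀ q)) := fun q => ((MvPolynomial.continuous_eval q).tendsto _).comp hx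
  have h1 : Tendsto (fun t => ∑ k ∈ weights w p, s t ^ (k - κ) *
      MvPolynomial.eval (x t) (weightComponent w k p)) l
      (𝓝 (∑ k ∈ weights w p, if k = κ then MvPolynomial.eval x₀ (weightComponent w k p) else 0)) := by
    refine tendsto_finsetSum _ fun k _ => ?_
    split_ifs with h2
    · simpa [h2] using hc _
    · rcases lt_or_gt_of_ne h2 with h3 | h3
      · simpa [h0 _ k h3] using tendsto_const_nhds
      · simpa using ((tendsto_rpow_nhdsGT_zero (sub_pos.2 h3)).comp hs).mul (hc _)
  have h2 : (∑ k ∈ weights w p, if k = κ then MvPolynomial.eval x₀ (weightComponent w k p) else 0)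
      = MvPolynomial.eval x₀ (weightComponent w κ p) := by
    rw [Finset.sum_ite_eq']
    split_ifs with h3
    · rfl
    · exact (eval_weightComponent_of_notMem h3 _).symm
  rw [h2] at h1
  refine h1.congr' ?_
  filter_upwards [hs.eventually self_mem_nhdsWithin] with t ht
  have ht : 0 < s t := ht
  rw [eval_dilate w p ht, Finset.mul_sum]
  refine Finset.sum_congr rfl fun k _ => ?_
  rw [← mul_assoc, ← Real.rpow_add ht]
  ring_nf

end Weights

/-! ### Polynomials in the real coordinates of ℂ^d -/

variable {d : ℕ}

/-- The real coordinates of a point of `ℂ^d`. -/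
def realCoord (z : Cn d) : Fin d ⊕ Fin d → ℝ := Sum.elim (fun j => (z j).re) (fun j => (z j).im)

theorem continuous_realCoord : Continuous (realCoord (d := d)) := by
  refine continuous_pi fun i => ?_
  rcases i with i | i <;> simp only [realCoord, Sum.elim_inl, Sum.elim_inr] <;> fun_prop

/-- The function on `ℂ^d` defined by a polynomial in the real coordinates. -/
noncomputable def polyFun (p : MvPolynomial (Fin d ⊕ Fin d) ℝ) (z : Cn d) : ℝ :=
  MvPolynomial.eval (realCoord z) p

theorem continuous_polyFun (p : MvPolynomial (Fin d ⊕ Fin d) ℝ) : Continuous (polyFun p) :=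
  (MvPolynomial.continuous_eval p).comp continuous_realCoord

theorem exists_taylor_polyFun {f : Cn d → ℝ} (hf : ContDiffAt ℝ ∞ f 0) (N : ℕ) :
    ∃ p, (fun z => f z - polyFun p z) =O[𝓝 0] fun z => ‖z‖ ^ N := by
  let π : Fin d → Cn d →L[ℝ] ℂ := fun j =>
    (EuclideanSpace.proj j : Cn d →L[ℂ] ℂ).restrictScalars ℝ
  have hsum : ∀ x : Cn d, ∑ i, (Sum.elim (fun j => Complex.reCLM ∘L π j)
      (fun j => Complex.imCLM ∘L π j) : Fin d ⊕ Fin d → Cn d →L[ℝ] ℝ) i x •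
      (Sum.elim (fun j => EuclideanSpace.single j (1 : ℂ))
      (fun j => EuclideanSpace.single j Complex.I) : Fin d ⊕ Fin d → Cn d) i = x := by
    intro x
    ext j
    simp only [Fintype.sum_sum_type, Sum.elim_inl, Sum.elim_inr, PiLp.add_apply, WithLp.ofLp_sum,
      Finset.sum_apply, PiLp.smul_apply, PiLp.single_apply]
    simp [π, Complex.re_add_im]
  obtain ⟨p, hp⟩ := exists_taylor_polynomial _ _ hsum N f (contDiffAt_infty.1 hf N)
  refine ⟨p, hp.congr_left fun z => ?_⟩
  congr 3
  funext i
  rcases i with i | i <;> rfl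

/-- The anisotropic dilation `zⱼ ↦ s ^ wⱼ zⱼ` of `ℂ^d`. -/
noncomputable def dil (w : Fin d → ℝ) (s : ℝ) (z : Cn d) : Cn d :=
  WithLp.toLp 2 fun j => ((s ^ w j : ℝ) : ℂ) * z j

theorem dil_apply (w : Fin d → ℝ) (s : ℝ) (z : Cn d) (j : Fin d) :
    dil w s z j = ((s ^ w j : ℝ) : ℂ) * z j := rfl

theorem realCoord_dil (w : Fin d → ℝ) (s : ℝ) (z : Cn d) :
    realCoord (dil w s z) = dilate (Sum.elim w w) s (realCoord z) := by
  funext i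
  rcases i with i | i <;>
    simp only [realCoord, dil_apply, dilate, Sum.elim_inl, Sum.elim_inr, Complex.re_ofReal_mul,
      Complex.im_ofReal_mul]

theorem dil_one (s : ℝ) (z : Cn d) : dil 1 s z = s • z := by
  ext j
  simp [dil_apply]

/-- The part of degree `r` of a polynomial, as a function on `ℂ^d`. -/
noncomputable def homPart (r : ℕ) (p : MvPolynomial (Fin d ⊕ Fin d) ℝ) (z : Cn d) : ℝ :=
  polyFun (weightComponent (Sum.elim 1 1) r p) z

theorem continuous_homPart (r : ℕ) (p : MvPolynomial (Fin d ⊕ Fin d) ℝ) :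
    Continuous (homPart r p) := continuous_polyFun _

theorem homPart_smul (r : ℕ) (p : MvPolynomial (Fin d ⊕ Fin d) ℝ) {s : ℝ} (hs : 0 < s) (z : Cn d) :
    homPart r p (s • z) = s ^ r * homPart r p z := by
  rw [homPart, polyFun, ← dil_one, realCoord_dil, eval_dilate_weightComponent _ _ _ hs,
    Real.rpow_natCast]
  rfl

theorem homPart_zero {r : ℕ} (hr : r ≠ 0) (p : MvPolynomial (Fin d ⊕ Fin d) ℝ) :
    homPart r p (0 : Cn d) = 0 := by
  have h := homPart_smul r p two_pos (0 : Cn d)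
  rw [smul_zero] at h
  have h2 : (1 : ℝ) < 2 ^ r := one_lt_pow₀ one_lt_two hr
  have : (2 ^ r - 1) * homPart r p (0 : Cn d) = 0 := by linarith
  exact (mul_eq_zero.1 this).resolve_left (by linarith)

/-! ### Order of vanishing and leading terms -/

theorem le_vanishingOrder_iff {g : ℂ → ℝ} {r : ℕ} :
    (r : ℕ∞) ≤ vanishingOrder g ↔ ∀ k < r, iteratedFDeriv ℝ k g 0 = 0 := by
  constructor
  · intro h k hk
    have : (k : ℕ∞) < vanishingOrder g := lt_of_lt_of_le (by exact_mod_cast hk) h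
    obtain ⟨r', hr', hk'⟩ := lt_sSup_iff.1 this
    exact hr' k hk'
  · intro h
    exact le_sSup fun k hk => h k (by exact_mod_cast hk)

theorem contDiffAt_complexLine {f : Cn d → ℝ} (hf : ContDiffAt ℝ ∞ f 0) (v : Cn d) :
    ContDiffAt ℝ ∞ (fun ζ : ℂ => f (ζ • v)) 0 := by
  refine ContDiffAt.comp (0 : ℂ) (f := fun ζ : ℂ => ζ • v) (g := f) (by simpa using hf) ?_
  exact (contDiff_id.smul contDiff_const).contDiffAt

theorem isBigO_of_le_ord {f : Cn d → ℝ} (hf : ContDiffAt ℝ ∞ f 0) {v : Cn d} {r : ℕ}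
    (h : (r : ℕ∞) ≤ ord f v) : (fun ζ : ℂ => f (ζ • v)) =O[𝓝 0] fun ζ => ‖ζ‖ ^ r :=
  isBigO_pow_of_iteratedFDeriv_eq_zero r (contDiffAt_infty.1 (contDiffAt_complexLine hf v) r)
    (le_vanishingOrder_iff.1 h)

theorem succ_le_ord_of_isLittleO {f : Cn d → ℝ} (hf : ContDiffAt ℝ ∞ f 0) {v : Cn d} {r : ℕ}
    (h : (r : ℕ∞) ≤ ord f v) (ho : (fun ζ : ℂ => f (ζ • v)) =o[𝓝 0] fun ζ => ‖ζ‖ ^ r) :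
    ((r + 1 : ℕ) : ℕ∞) ≤ ord f v := by
  have h1 := le_vanishingOrder_iff.1 h
  refine le_vanishingOrder_iff.2 fun k hk => ?_
  rcases Nat.lt_succ_iff_lt_or_eq.1 hk with hk | rfl
  · exact h1 k hk
  · exact iteratedFDeriv_eq_zero_of_isLittleO k (contDiffAt_complexLine hf v) h1 ho

/-- The order is measured along a complex line, so it controls every real ray in that line. -/
theorem le_ord_smul {f : Cn d → ℝ} (hf : ContDiffAt ℝ ∞ f 0) {v : Cn d} {r : ℕ}
    (h : (r : ℕ∞) ≤ ord f v) (ζ : ℂ) :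
    (fun s : ℝ => f (s • ζ • v)) =O[𝓝[>] 0] fun s => s ^ (r : ℝ) := by
  have h1 : Tendsto (fun s : ℝ => (s : ℂ) * ζ) (𝓝[>] 0) (𝓝 0) := by
    have : Continuous fun s : ℝ => (s : ℂ) * ζ := by fun_prop
    simpa using (this.tendsto 0).mono_left nhdsWithin_le_nhds
  have h2 := (isBigO_of_le_ord hf h).comp_tendsto h1
  have h3 : (fun s : ℝ => ‖(s : ℂ) * ζ‖ ^ r) =O[𝓝[>] 0] fun s => s ^ (r : ℝ) := by
    refine IsBigO.of_bound (‖ζ‖ ^ r) (Eventually.of_forall fun s => ?_)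
    rw [norm_pow, norm_norm, norm_mul, mul_pow, Real.rpow_natCast, norm_pow, Complex.norm_real,
      mul_comm]
  refine (h2.trans h3).congr_left fun s => ?_
  simp only [Function.comp, ← smul_smul]
  rfl

section Expansion

variable {f : Cn d → ℝ} {p : MvPolynomial (Fin d ⊕ Fin d) ℝ} {N : ℕ}

theorem taylor_remainder_line (hp : (fun z => f z - polyFun p z) =O[𝓝 0] fun z => ‖z‖ ^ N)
    (v : Cn d) : (fun s : ℝ => f (s • v) - polyFun p (s • v)) =O[𝓝[>] 0] fun s => s ^ (N : ℝ) := by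
  have h1 : Tendsto (fun s : ℝ => s • v) (𝓝[>] 0) (𝓝 0) := by
    have : Continuous fun s : ℝ => s • v := by fun_prop
    simpa using (this.tendsto 0).mono_left nhdsWithin_le_nhds
  refine (hp.comp_tendsto h1).trans (IsBigO.of_bound (‖v‖ ^ N) (Eventually.of_forall fun s => ?_))
  simp only [Function.comp]
  rw [norm_pow, norm_norm, norm_smul, mul_pow, Real.rpow_natCast, norm_pow, mul_comm]

theorem isBigO_rpow_rpow {a b : ℝ} (hab : a ≤ b) :
    (fun s : ℝ => s ^ b) =O[𝓝[>] 0] fun s => s ^ a := by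
  refine IsBigO.of_bound 1 ?_
  filter_upwards [Ioo_mem_nhdsGT (zero_lt_one (α := ℝ))] with s hs
  rw [one_mul, Real.norm_of_nonneg (Real.rpow_nonneg hs.1.le _),
    Real.norm_of_nonneg (Real.rpow_nonneg hs.1.le _)]
  exact Real.rpow_le_rpow_of_exponent_ge hs.1 hs.2.le hab

theorem isBigO_polyFun_line (hf : ContDiffAt ℝ ∞ f 0)
    (hp : (fun z => f z - polyFun p z) =O[𝓝 0] fun z => ‖z‖ ^ N) {v : Cn d} {r : ℕ}
    (h : (r : ℕ∞) ≤ ord f v) (hr : r ≤ N) (ζ : ℂ) :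
    (fun s : ℝ => MvPolynomial.eval (dilate (Sum.elim 1 1) s (realCoord (ζ • v))) p) =O[𝓝[>] 0]
      fun s => s ^ (r : ℝ) := by
  have h1 := (le_ord_smul hf h ζ).sub ((taylor_remainder_line hp (ζ • v)).trans
    (isBigO_rpow_rpow (by exact_mod_cast hr)))
  refine h1.congr_left fun s => ?_
  rw [sub_sub_cancel, ← realCoord_dil, dil_one]
  rfl

/-- The leading term of `f` along directions of order of vanishing at least `r`. -/
theorem tendsto_homPart (hf : ContDiffAt ℝ ∞ f 0)
    (hp : (fun z => f z - polyFun p z) =O[𝓝 0] fun z => ‖z‖ ^ N) {v : Cn d} {r : ℕ}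
    (h : (r : ℕ∞) ≤ ord f v) (hr : r < N) :
    Tendsto (fun s : ℝ => s ^ (-(r : ℝ)) * f (s • v)) (𝓝[>] 0) (𝓝 (homPart r p v)) := by
  have h0 := isBigO_polyFun_line hf hp h hr.le 1
  rw [one_smul] at h0
  have h1 := tendsto_eval_dilate (κ := (r : ℝ)) (w := Sum.elim 1 1) (p := p)
    (s := fun s : ℝ => s) (x := fun _ => realCoord v) tendsto_id tendsto_const_nhds
    (fun _ k hk => eval_weightComponent_eq_zero h0 hk)
  have h2 : Tendsto (fun s : ℝ => s ^ (-(r : ℝ)) * (f (s • v) - polyFun p (s • v))) (𝓝[>] 0)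
      (𝓝 0) := by
    have h3 := (isBigO_refl (fun s : ℝ => s ^ (-(r : ℝ))) (𝓝[>] 0)).mul (taylor_remainder_line hp v)
    refine (h3.congr' EventuallyEq.rfl ?_).trans_tendsto
      (tendsto_rpow_nhdsGT_zero (a := (N : ℝ) - r) (sub_pos.2 (by exact_mod_cast hr)))
    filter_upwards [self_mem_nhdsWithin] with s hs
    rw [← Real.rpow_add hs]
    ring_nf
  have h4 := h1.add h2
  rw [add_zero] at h4
  refine h4.congr fun s => ?_
  rw [← mul_add, ← realCoord_dil, dil_one, polyFun, add_sub_cancel]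

theorem homPart_eq_zero_of_succ_le_ord (hf : ContDiffAt ℝ ∞ f 0)
    (hp : (fun z => f z - polyFun p z) =O[𝓝 0] fun z => ‖z‖ ^ N) {v : Cn d} {r : ℕ}
    (h : ((r + 1 : ℕ) : ℕ∞) ≤ ord f v) (hr : r < N) (ζ : ℂ) : homPart r p (ζ • v) = 0 := by
  refine eval_weightComponent_eq_zero (isBigO_polyFun_line hf hp h hr ζ) ?_
  exact_mod_cast Nat.lt_succ_self r

/-- If the leading term vanishes on a complex line, the order of vanishing is larger. -/
theorem succ_le_ord_of_homPart_eq_zero (hf : ContDiffAt ℝ ∞ f 0) (hf0 : f 0 = 0)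
    (hp : (fun z => f z - polyFun p z) =O[𝓝 0] fun z => ‖z‖ ^ N) {v : Cn d} {r : ℕ}
    (h : (r : ℕ∞) ≤ ord f v) (hr : r < N) (h0 : ∀ ζ : ℂ, homPart r p (ζ • v) = 0) :
    ((r + 1 : ℕ) : ℕ∞) ≤ ord f v := by
  refine succ_le_ord_of_isLittleO hf h ?_
  -- On the complex line ℂv the components of degree below r vanish because of the order of f, the
  -- one of degree r by hypothesis.
  have hlow : ∀ (l : ℝ), l ≤ r → ∀ ζ : ℂ,
      polyFun (weightComponent (Sum.elim 1 1) l p) (ζ • v) = 0 := by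
    intro l hl ζ
    rcases hl.lt_or_eq with hl | rfl
    · exact eval_weightComponent_eq_zero (isBigO_polyFun_line hf hp h hr.le ζ) hl
    · exact h0 ζ
  have hpow : ∀ {a b : ℝ}, a < b → (fun ζ : ℂ => ‖ζ‖ ^ b) =o[𝓝[≠] 0] fun ζ => ‖ζ‖ ^ a := by
    intro a b hab
    have hn : Tendsto (fun ζ : ℂ => ‖ζ‖) (𝓝[≠] 0) (𝓝[>] 0) := tendsto_norm_nhdsNE_zero
    refine isLittleO_of_tendsto' ?_ ?_
    · filter_upwards [self_mem_nhdsWithin] with ζ hζ h1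
      exact absurd h1 (Real.rpow_pos_of_pos (norm_pos_iff.2 hζ) _).ne'
    · refine ((tendsto_rpow_nhdsGT_zero (sub_pos.2 hab)).comp hn).congr' ?_
      filter_upwards [self_mem_nhdsWithin] with ζ hζ
      simp only [Function.comp]
      rw [Real.rpow_sub (norm_pos_iff.2 hζ)]
  have h1 : (fun ζ : ℂ => polyFun p (ζ • v)) =o[𝓝[≠] 0] fun ζ => ‖ζ‖ ^ (r : ℝ) := by
    -- Polar form: each component contributes ‖ζ‖^l times a function bounded on the unit circle, and
    -- only l > r survive.
    have h2 : (fun ζ : ℂ => ∑ l ∈ weights (Sum.elim 1 1) p, ‖ζ‖ ^ l *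
        polyFun (weightComponent (Sum.elim 1 1) l p) (((‖ζ‖⁻¹ : ℝ) * ζ : ℂ) • v))
        =o[𝓝[≠] 0] fun ζ => ‖ζ‖ ^ (r : ℝ) := by
      refine IsLittleO.fun_sum fun l _ => ?_
      rcases le_or_gt l (r : ℝ) with hl | hl
      · simp only [hlow l hl, mul_zero]
        exact isLittleO_zero _ _
      · have hcont : Continuous fun ζ : ℂ =>
            polyFun (weightComponent (Sum.elim 1 1) l p) (ζ • v) :=
          (continuous_polyFun _).comp (by fun_prop)
        obtain ⟨C, hC⟩ := (isCompact_closedBall (0 : ℂ) 1).exists_bound_of_continuousOn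
          hcont.continuousOn
        have h3 : (fun ζ : ℂ => polyFun (weightComponent (Sum.elim 1 1) l p)
            (((‖ζ‖⁻¹ : ℝ) * ζ : ℂ) • v)) =O[𝓝[≠] 0] fun _ => (1 : ℝ) := by
          refine IsBigO.of_bound C (Eventually.of_forall fun ζ => ?_)
          rw [norm_one, mul_one]
          refine hC _ ?_
          rw [mem_closedBall_zero_iff, norm_mul, Complex.norm_real, norm_inv, norm_norm]
          exact inv_mul_le_one
        simpa using (hpow hl).mul_isBigO h3
    refine h2.congr' ?_ EventuallyEq.rfl
    filter_upwards [self_mem_nhdsWithin] with ζ hζ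
    have hζ' : 0 < ‖ζ‖ := norm_pos_iff.2 hζ
    have e : ζ • v = ‖ζ‖ • ((((‖ζ‖⁻¹ : ℝ) * ζ : ℂ)) • v) := by
      rw [← Complex.coe_smul, smul_smul]
      congr 1
      have : (‖ζ‖ : ℂ) ≠ 0 := by exact_mod_cast hζ'.ne'
      push_cast
      field_simp
    rw [congrArg (polyFun p) e, polyFun, ← dil_one, realCoord_dil]
    have := eval_dilate (Sum.elim 1 1) p hζ' (realCoord ((((‖ζ‖⁻¹ : ℝ) * ζ : ℂ)) • v))
    exact this.symm
  have h2 : (fun ζ : ℂ => f (ζ • v) - polyFun p (ζ • v)) =o[𝓝[≠] 0] fun ζ => ‖ζ‖ ^ (r : ℝ) := by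
    have ht : Tendsto (fun ζ : ℂ => ζ • v) (𝓝[≠] 0) (𝓝 0) := by
      have : Continuous fun ζ : ℂ => ζ • v := by fun_prop
      simpa using (this.tendsto 0).mono_left nhdsWithin_le_nhds
    refine ((hp.comp_tendsto ht).trans (?_ : _ =O[𝓝[≠] 0] fun ζ : ℂ => ‖ζ‖ ^ (N : ℝ))).trans_isLittleO
      (hpow (by exact_mod_cast hr))
    refine IsBigO.of_bound (‖v‖ ^ N) (Eventually.of_forall fun ζ => ?_)
    simp only [Function.comp]
    rw [norm_pow, norm_norm, norm_smul, mul_pow, Real.rpow_natCast, norm_pow, norm_norm, mul_comm]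
  have h3 : (fun ζ : ℂ => f (ζ • v)) =o[𝓝[≠] 0] fun ζ => ‖ζ‖ ^ r := by
    simpa using h2.add h1
  -- The punctured estimate extends to ζ = 0 because f(0) = 0.
  have h4 := (isLittleO_insert (x := (0 : ℂ)) (s := {0}ᶜ) (by simp [hf0])).2 h3
  have h5 : insert (0 : ℂ) {0}ᶜ = univ := by ext; simp [em]
  rwa [h5, nhdsWithin_univ] at h4

end Expansion

theorem eventually_smul_mem_ball {ρ : ℝ} (hρ : 0 < ρ) (v : Cn d) :
    ∀ᶠ s : ℝ in 𝓝[>] 0, s • v ∈ Metric.ball (0 : Cn d) ρ := by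
  have h1 : Tendsto (fun s : ℝ => s • v) (𝓝[>] 0) (𝓝 0) := by
    have : Continuous fun s : ℝ => s • v := by fun_prop
    simpa using (this.tendsto 0).mono_left nhdsWithin_le_nhds
  exact h1.eventually (Metric.ball_mem_nhds _ hρ)

section LeadingTerm

variable {f : Cn d → ℝ} {p : MvPolynomial (Fin d ⊕ Fin d) ℝ} {N : ℕ} {ρ : ℝ}

/-- On W the leading term is the pointwise limit of the convex functions s^(-r) f(s ·); the bound on
the order is what makes these converge. -/
theorem homPart_convexOn (hf : ContDiffAt ℝ ∞ f 0) (hρ : 0 < ρ)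
    (hconv : ConvexOn ℝ (Metric.ball 0 ρ) f)
    (hp : (fun z => f z - polyFun p z) =O[𝓝 0] fun z => ‖z‖ ^ N) {r : ℕ} (hr : r < N)
    {W : Submodule ℂ (Cn d)} (hW : ∀ v ∈ W, (r : ℕ∞) ≤ ord f v) :
    ConvexOn ℝ (W : Set (Cn d)) (homPart r p) := by
  have hWc : Convex ℝ (W : Set (Cn d)) := (W.restrictScalars ℝ).convex
  refine ⟨hWc, fun u hu v hv a b ha hb hab => ?_⟩
  refine le_of_tendsto_of_tendsto (tendsto_homPart hf hp (hW _ (hWc hu hv ha hb hab)) hr)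
    (((tendsto_homPart hf hp (hW _ hu) hr).const_smul a).add
      ((tendsto_homPart hf hp (hW _ hv) hr).const_smul b)) ?_
  filter_upwards [eventually_smul_mem_ball hρ u, eventually_smul_mem_ball hρ v,
    self_mem_nhdsWithin] with s h1 h2 hs
  have h3 := hconv.2 h1 h2 ha hb hab
  have e : s • (a • u + b • v) = a • s • u + b • s • v := by
    rw [smul_add, smul_comm s a, smul_comm s b]
  rw [e]
  simp only [smul_eq_mul] at h3 ⊢
  have h4 : 0 ≤ s ^ (-(r : ℝ)) := Real.rpow_nonneg (le_of_lt hs) _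
  nlinarith [mul_le_mul_of_nonneg_left h3 h4]

theorem homPart_nonneg (hf : ContDiffAt ℝ ∞ f 0) (hρ : 0 < ρ)
    (hnn : ∀ z ∈ Metric.ball 0 ρ, 0 ≤ f z)
    (hp : (fun z => f z - polyFun p z) =O[𝓝 0] fun z => ‖z‖ ^ N) {r : ℕ} (hr : r < N)
    {v : Cn d} (hv : (r : ℕ∞) ≤ ord f v) : 0 ≤ homPart r p v := by
  refine ge_of_tendsto (tendsto_homPart hf hp hv hr) ?_
  filter_upwards [eventually_smul_mem_ball hρ v, self_mem_nhdsWithin] with s h1 hs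
  exact mul_nonneg (Real.rpow_nonneg (le_of_lt hs) _) (hnn _ h1)

end LeadingTerm

/-! ### The nearest point of a superlevel set -/

theorem norm_sq_real_combination {ξ u : Cn d} (h : inner ℂ ξ u = 0) (a b : ℝ) :
    ‖a • ξ + b • u‖ ^ 2 = a ^ 2 * ‖ξ‖ ^ 2 + b ^ 2 * ‖u‖ ^ 2 := by
  have h1 : inner ℂ (a • ξ) (b • u) = 0 := by
    rw [← Complex.coe_smul, ← Complex.coe_smul, inner_smul_left, inner_smul_right, h]
    simp
  rw [sq, norm_add_sq_eq_norm_sq_add_norm_sq_of_inner_eq_zero _ _ h1, norm_smul, norm_smul,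
    Real.norm_eq_abs, Real.norm_eq_abs, mul_mul_mul_comm, abs_mul_abs_self,
    mul_mul_mul_comm |b|, abs_mul_abs_self]
  ring

/-- A point of minimal norm in `{h ≥ 1} ∩ W` for a convex function `h` that is homogeneous of
positive degree. -/
theorem exists_nearest_point {W : Submodule ℂ (Cn d)} {h : Cn d → ℝ} {r : ℕ}
    (hc : Continuous h) (hconv : ConvexOn ℝ (W : Set (Cn d)) h)
    (hhom : ∀ s : ℝ, 0 < s → ∀ v, h (s • v) = s ^ r * h v) (hr : r ≠ 0) (h0 : h 0 = 0)
    (hpos : ∃ v ∈ W, 0 < h v) :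
    ∃ ξ ∈ W, 1 ≤ h ξ ∧ (∀ w ∈ W, ‖w‖ < ‖ξ‖ → h w < 1) ∧
      ∀ u ∈ W, inner ℂ ξ u = 0 → 1 ≤ h (ξ + u) := by
  have hcl : IsClosed ((W : Set (Cn d)) ∩ {v | 1 ≤ h v}) :=
    W.closed_of_finiteDimensional.inter (isClosed_le continuous_const hc)
  have hne : ((W : Set (Cn d)) ∩ {v | 1 ≤ h v}).Nonempty := by
    obtain ⟨v, hv, hvp⟩ := hpos
    -- With s ≥ 1 and r ≠ 0 one has s ≤ s^r, so s ≥ 1 / h v suffices.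
    obtain ⟨s, hs, hs1⟩ : ∃ s : ℝ, 1 ≤ s ∧ 1 / h v ≤ s := ⟨max 1 (1 / h v), le_max_left _ _,
      le_max_right _ _⟩
    have hs0 : 0 < s := by linarith
    refine ⟨s • v, (W.restrictScalars ℝ).smul_mem s hv, ?_⟩
    change 1 ≤ h (s • v)
    rw [hhom s hs0]
    have h2 : s ≤ s ^ r := le_self_pow₀ hs hr
    calc (1 : ℝ) = 1 / h v * h v := by field_simp
      _ ≤ s ^ r * h v := by gcongr; exact hs1.trans h2
  obtain ⟨ξ, ⟨hξW, hξ1⟩, hξ⟩ := hcl.exists_infDist_eq_dist hne 0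
  have hmin : ∀ w ∈ W, ‖w‖ < ‖ξ‖ → h w < 1 := by
    intro w hw hlt
    by_contra! hge
    have := Metric.infDist_le_dist_of_mem (x := (0 : Cn d)) (s := (W : Set (Cn d)) ∩ {v | 1 ≤ h v})
      ⟨hw, hge⟩
    rw [hξ, dist_zero_left, dist_zero_left] at this
    linarith
  refine ⟨ξ, hξW, hξ1, hmin, fun u hu hin => ?_⟩
  by_contra! hlt
  have hξ0 : 0 < ‖ξ‖ := by
    rw [norm_pos_iff]
    rintro rfl
    have : (1 : ℝ) ≤ h 0 := hξ1
    linarith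
  -- If h(ξ + u) < 1, then also h < 1 at ξ + u + κξ for small κ > 0. The segment from there through
  -- ξ continues to ξ - τ(u + κξ), which is closer to 0 than ξ, so that h < 1 there too. By
  -- convexity h(ξ) < 1, a contradiction.
  have hcont : Continuous fun κ : ℝ => h (ξ + u + κ • ξ) := by fun_prop
  have hev : ∀ᶠ κ : ℝ in 𝓝[>] 0, h (ξ + u + κ • ξ) < 1 := by
    have : Tendsto (fun κ : ℝ => h (ξ + u + κ • ξ)) (𝓝[>] 0) (𝓝 (h (ξ + u))) := by
      simpa using (hcont.tendsto 0).mono_left nhdsWithin_le_nhds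
    exact this.eventually (gt_mem_nhds hlt)
  obtain ⟨κ, hκlt, hκ⟩ := (hev.and self_mem_nhdsWithin).exists
  have hκ : 0 < κ := hκ
  set D := κ ^ 2 * ‖ξ‖ ^ 2 + ‖u‖ ^ 2 with hD
  have hDpos : 0 < D := by positivity
  -- This τ minimizes ‖ξ - τ(u + κξ)‖² = ‖ξ‖² - 2τκ‖ξ‖² + τ²D.
  set τ := κ * ‖ξ‖ ^ 2 / D with hτ
  have hτpos : 0 < τ := by positivity
  have hτD : τ * D = κ * ‖ξ‖ ^ 2 := by rw [hτ]; field_simp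
  have hWR : ∀ (a : ℝ) {v : Cn d}, v ∈ W → a • v ∈ W := fun a v hv =>
    (W.restrictScalars ℝ).smul_mem a hv
  have hq : ξ + u + κ • ξ ∈ W := W.add_mem (W.add_mem hξW hu) (hWR κ hξW)
  have hpW : (1 - τ * κ) • ξ + (-τ) • u ∈ W := W.add_mem (hWR _ hξW) (hWR _ hu)
  have hpn : ‖(1 - τ * κ) • ξ + (-τ) • u‖ < ‖ξ‖ := by
    refine lt_of_pow_lt_pow_left₀ 2 hξ0.le ?_
    rw [norm_sq_real_combination hin]
    have : (1 - τ * κ) ^ 2 * ‖ξ‖ ^ 2 + (-τ) ^ 2 * ‖u‖ ^ 2 =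
        ‖ξ‖ ^ 2 - 2 * τ * (κ * ‖ξ‖ ^ 2) + τ * (τ * D) := by rw [hD]; ring
    rw [this, hτD]
    have : 0 < τ * (κ * ‖ξ‖ ^ 2) := by positivity
    linarith
  have hp1 := hmin _ hpW hpn
  have hcv := hconv.2 hq hpW (by positivity : 0 ≤ τ / (1 + τ)) (by positivity : 0 ≤ 1 / (1 + τ))
    (by field_simp; ring)
  have e : (τ / (1 + τ)) • (ξ + u + κ • ξ) + (1 / (1 + τ)) • ((1 - τ * κ) • ξ + (-τ) • u) = ξ := by
    have h1 : (1 + τ) ≠ 0 := by positivity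
    have : (τ / (1 + τ)) • (ξ + u + κ • ξ) + (1 / (1 + τ)) • ((1 - τ * κ) • ξ + (-τ) • u) =
        (τ / (1 + τ) * (1 + κ) + 1 / (1 + τ) * (1 - τ * κ)) • ξ +
          (τ / (1 + τ) - 1 / (1 + τ) * τ) • u := by module
    rw [this]
    have e1 : τ / (1 + τ) * (1 + κ) + 1 / (1 + τ) * (1 - τ * κ) = 1 := by field_simp; ring
    have e2 : τ / (1 + τ) - 1 / (1 + τ) * τ = 0 := by field_simp; ring
    rw [e1, e2, one_smul, zero_smul, add_zero]
  rw [e] at hcv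
  have hξ1 : 1 ≤ h ξ := hξ1
  simp only [smul_eq_mul] at hcv
  have h5 : τ / (1 + τ) * h (ξ + u + κ • ξ) < τ / (1 + τ) * 1 := by gcongr
  have h6 : 1 / (1 + τ) * h ((1 - τ * κ) • ξ + (-τ) • u) < 1 / (1 + τ) * 1 := by gcongr
  have h7 : τ / (1 + τ) * 1 + 1 / (1 + τ) * 1 = 1 := by field_simp; ring
  linarith

/-! ### A flag and a frame adapted to the order of vanishing -/

section Adapted

variable {f : Cn d → ℝ} {p : MvPolynomial (Fin d ⊕ Fin d) ℝ} {N : ℕ} {ρ : ℝ} {m : Fin d → ℕ}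

/-- A subspace of codimension `j` squeezed between two sublevel spaces of the order of
vanishing. -/
def IsOrderFlag (f : Cn d → ℝ) (j : ℕ) (W : Submodule ℂ (Cn d)) : Prop :=
  Module.finrank ℂ W = d - j ∧ ∃ r : ℕ, r ≠ 0 ∧ (∀ v ∈ W, (r : ℕ∞) ≤ ord f v) ∧
    ∀ v, ((r + 1 : ℕ) : ℕ∞) ≤ ord f v → v ∈ W

theorem one_le_ord (hf0 : f 0 = 0) (v : Cn d) : ((1 : ℕ) : ℕ∞) ≤ ord f v := by
  refine le_vanishingOrder_iff.2 fun k hk => ?_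
  obtain rfl : k = 0 := by lia
  rw [← norm_eq_zero, norm_iteratedFDeriv_zero]
  simp [hf0]

theorem isOrderFlag_top (hf0 : f 0 = 0) : IsOrderFlag f 0 ⊤ :=
  ⟨by simp, 1, one_ne_zero, fun v _ => one_le_ord hf0 v, fun _ _ => trivial⟩

/-- The next space is the orthogonal complement in W of the nearest point of {h ≥ 1}, with h the
leading term of f on W. Being squeezed between two consecutive orders is what survives this step and
what identifies the common order on W with `m j` by a dimension count. -/
theorem exists_next_orderFlag (hf : ContDiffAt ℝ ∞ f 0) (hf0 : f 0 = 0) (hρ : 0 < ρ)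
    (hconv : ConvexOn ℝ (Metric.ball 0 ρ) f) (hnn : ∀ z ∈ Metric.ball 0 ρ, 0 ≤ f z)
    (hp : (fun z => f z - polyFun p z) =O[𝓝 0] fun z => ‖z‖ ^ N)
    (hm : ∀ j, (m j : ℕ∞) = typeAtZero f j) (hN : ∀ j, m j < N) (j : Fin d)
    {W : Submodule ℂ (Cn d)} (hW : IsOrderFlag f j W) :
    ∃ ξ ∈ W, ∃ W' ≤ W, IsOrderFlag f (j + 1) W' ∧ m j ≠ 0 ∧ (∀ v ∈ W, (m j : ℕ∞) ≤ ord f v) ∧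
      (∀ w ∈ W, ‖w‖ < ‖ξ‖ → homPart (m j) p w < 1) ∧
      ∀ u ∈ W', 1 ≤ homPart (m j) p (ξ + u) := by
  obtain ⟨hdim, r₀, hr₀, hWr₀, hr₀W⟩ := hW
  have hmem : ∀ r : ℕ∞, (∀ v ∈ W, r ≤ ord f v) → r ≤ m j := by
    intro r hr
    rw [hm j]
    refine le_sSup ?_
    change d - (j : ℕ) ≤ _
    rw [← hdim]
    exact Submodule.finrank_mono fun v hv => Submodule.subset_span (hr v hv)
  -- The largest order common to all of W. If there were none, f would have infinite order on W, and
  -- the type at j would be infinite.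
  obtain ⟨r, hr₀r, hWr, v₀, hv₀, hv₀r⟩ : ∃ r : ℕ, r₀ ≤ r ∧ (∀ v ∈ W, (r : ℕ∞) ≤ ord f v) ∧
      ∃ v ∈ W, ¬ ((r + 1 : ℕ) : ℕ∞) ≤ ord f v := by
    by_contra! hcon
    have hall : ∀ r : ℕ, r₀ ≤ r → ∀ v ∈ W, (r : ℕ∞) ≤ ord f v := by
      intro r hr
      induction r, hr using Nat.le_induction with
      | base => exact hWr₀
      | succ r hr ih => exact hcon r hr ih
    have := hmem ⊤ fun v hv => by
      rw [top_le_iff, ENat.eq_top_iff_forall_ge]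
      intro n
      exact le_trans (by exact_mod_cast le_max_left n r₀) (hall (max n r₀) (le_max_right _ _) v hv)
    simp at this
  have hrm : r ≤ m j := by exact_mod_cast hmem r hWr
  have hrN : r < N := hrm.trans_lt (hN j)
  have hr0 : r ≠ 0 := by lia
  have hpos : ∃ v ∈ W, 0 < homPart r p v := by
    by_contra! hle
    refine hv₀r (succ_le_ord_of_homPart_eq_zero hf hf0 hp (hWr v₀ hv₀) hrN fun ζ => ?_)
    have hζ := W.smul_mem ζ hv₀
    exact le_antisymm (hle _ hζ) (homPart_nonneg hf hρ hnn hp hrN (hWr _ hζ))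
  obtain ⟨ξ, hξW, hξ1, hξmin, hξu⟩ := exists_nearest_point (continuous_homPart r p)
    (homPart_convexOn hf hρ hconv hp hrN hWr) (fun s hs v => homPart_smul r p hs v) hr0
    (homPart_zero hr0 p) hpos
  have hξ0 : ξ ≠ 0 := by
    rintro rfl
    rw [homPart_zero hr0 p] at hξ1
    linarith
  set W' : Submodule ℂ (Cn d) := (ℂ ∙ ξ)ᗮ ⊓ W with hW'
  have hW'mem : ∀ v, v ∈ W' ↔ inner ℂ ξ v = 0 ∧ v ∈ W := fun v => by
    rw [hW', Submodule.mem_inf, Submodule.mem_orthogonal_singleton_iff_inner_right]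
  have hdim' : Module.finrank ℂ W' = d - (j + 1) := by
    have h1 := Submodule.finrank_add_inf_finrank_orthogonal (K₁ := ℂ ∙ ξ) (K₂ := W)
      ((Submodule.span_singleton_le_iff_mem ξ W).2 hξW)
    rw [finrank_span_singleton hξ0, hdim, ← hW'] at h1
    omega
  have hordW' : ∀ v, ((r + 1 : ℕ) : ℕ∞) ≤ ord f v → v ∈ W' := by
    intro v hv
    have hvW : v ∈ W := hr₀W v (le_trans (by exact_mod_cast (by lia)) hv)
    refine (hW'mem v).2 ⟨?_, hvW⟩
    by_contra hne
    -- If v is not orthogonal to ξ, the multiple ζv lies in ξ + W', where the leading term is at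
    -- least 1; but it vanishes on ℂv, the order along v being larger than r.
    set ζ : ℂ := inner ℂ ξ ξ / inner ℂ ξ v
    have h1 := hξu (ζ • v - ξ) (W.sub_mem (W.smul_mem _ hvW) hξW) (by
      rw [inner_sub_right, inner_smul_right, div_mul_cancel₀ _ hne, sub_self])
    rw [add_sub_cancel, homPart_eq_zero_of_succ_le_ord hf hp hv hrN] at h1
    linarith
  have hrm' : r = m j := by
    refine le_antisymm hrm ?_
    by_contra! hlt
    -- Otherwise `V f r'` with some r' > r would have dimension at least d - j, although it lies in
    -- W', of dimension d - j - 1.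
    have h1 : (r : ℕ∞) < typeAtZero f j := by rw [← hm j]; exact_mod_cast hlt
    obtain ⟨r', hr', hrr'⟩ := lt_sSup_iff.1 h1
    have h2 : V f r' ≤ W' := by
      refine Submodule.span_le.2 fun v hv => hordW' v (le_trans ?_ hv)
      exact_mod_cast Order.add_one_le_of_lt hrr'
    have h3 := Submodule.finrank_mono h2
    have h4 : d - (j : ℕ) ≤ Module.finrank ℂ (V f r') := hr'
    have := j.2
    omega
  subst hrm'
  refine ⟨ξ, hξW, W', inf_le_right, ⟨hdim', m j, hr0, fun v hv => hWr v ((hW'mem v).1 hv).2,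
    hordW'⟩, hr0, hWr, hξmin, fun u hu => ?_⟩
  exact hξu u ((hW'mem u).1 hu).2 ((hW'mem u).1 hu).1

/-- Directions adapted to the order of vanishing of a convex function. -/
structure IsAdapted (f : Cn d → ℝ) (p : MvPolynomial (Fin d ⊕ Fin d) ℝ) (m : Fin d → ℕ)
    (W : ℕ → Submodule ℂ (Cn d)) (ξ : Fin d → Cn d) : Prop where
  anti : Antitone W
  mem : ∀ j : Fin d, ξ j ∈ W j
  ne_zero : ∀ j, m j ≠ 0
  le_ord : ∀ j : Fin d, ∀ v ∈ W j, (m j : ℕ∞) ≤ ord f v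
  lt_one : ∀ j : Fin d, ∀ w ∈ W j, ‖w‖ < ‖ξ j‖ → homPart (m j) p w < 1
  one_le : ∀ j : Fin d, ∀ u ∈ W (j + 1), 1 ≤ homPart (m j) p (ξ j + u)

theorem exists_isAdapted (hf : ContDiffAt ℝ ∞ f 0) (hf0 : f 0 = 0) (hρ : 0 < ρ)
    (hconv : ConvexOn ℝ (Metric.ball 0 ρ) f) (hnn : ∀ z ∈ Metric.ball 0 ρ, 0 ≤ f z)
    (hp : (fun z => f z - polyFun p z) =O[𝓝 0] fun z => ‖z‖ ^ N)
    (hm : ∀ j, (m j : ℕ∞) = typeAtZero f j) (hN : ∀ j, m j < N) :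
    ∃ W ξ, IsAdapted f p m W ξ := by
  have hstep : ∀ (j : ℕ) (W : {W : Submodule ℂ (Cn d) // IsOrderFlag f j W}),
      ∃ (W' : {W : Submodule ℂ (Cn d) // IsOrderFlag f (j + 1) W}), W'.1 ≤ W.1 ∧
        ∀ hj : j < d, ∃ ξ ∈ W.1, m ⟨j, hj⟩ ≠ 0 ∧ (∀ v ∈ W.1, (m ⟨j, hj⟩ : ℕ∞) ≤ ord f v) ∧
          (∀ w ∈ W.1, ‖w‖ < ‖ξ‖ → homPart (m ⟨j, hj⟩) p w < 1) ∧
          ∀ u ∈ W'.1, 1 ≤ homPart (m ⟨j, hj⟩) p (ξ + u) := by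
    rintro j ⟨W, hW⟩
    by_cases hj : j < d
    · obtain ⟨ξ, hξ, W', hle, hflag, h1⟩ :=
        exists_next_orderFlag hf hf0 hρ hconv hnn hp hm hN ⟨j, hj⟩ hW
      exact ⟨⟨W', hflag⟩, hle, fun _ => ⟨ξ, hξ, h1⟩⟩
    -- For j ≥ d the truncated differences d - j and d - (j + 1) are both 0, so the flag may stay
    -- constant.
    · refine ⟨⟨W, ?_, hW.2⟩, le_rfl, fun h => absurd h hj⟩
      have := hW.1
      omega
  choose next hle hnext using hstep
  let W : (j : ℕ) → {W : Submodule ℂ (Cn d) // IsOrderFlag f j W} :=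
    Nat.rec ⟨⊤, isOrderFlag_top hf0⟩ fun j W => next j W
  have hW : ∀ j, W (j + 1) = next j (W j) := fun j => rfl
  choose ξ hξ h0 h1 h2 h3 using fun j : Fin d => hnext j (W j) j.2
  refine ⟨fun j => (W j).1, ξ, antitone_nat_of_succ_le fun j => hle j (W j), hξ, h0, h1, h2, h3⟩

end Adapted

/-! ### Convex germs, frames and the model function -/

/-- `f` is smooth at `0`, and convex and non-negative on a ball, with `f 0 = 0`. -/
structure IsConvexGerm (f : Cn d → ℝ) (ρ : ℝ) : Prop where
  contDiffAt : ContDiffAt ℝ ∞ f 0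
  map_zero : f 0 = 0
  pos : 0 < ρ
  convexOn : ConvexOn ℝ (Metric.ball 0 ρ) f
  nonneg : ∀ z ∈ Metric.ball 0 ρ, 0 ≤ f z

/-- The linear map sending the standard basis to `ξ`. -/
noncomputable def frameMap (ξ : Fin d → Cn d) : Cn d →ₗ[ℂ] Cn d where
  toFun z := ∑ j, z j • ξ j
  map_add' x y := by simp [add_smul, Finset.sum_add_distrib]
  map_smul' c x := by simp [mul_smul, Finset.smul_sum]

theorem frameMap_apply (ξ : Fin d → Cn d) (z : Cn d) : frameMap ξ z = ∑ j, z j • ξ j := rfl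

theorem frameMap_single (ξ : Fin d → Cn d) (j : Fin d) (ζ : ℂ) :
    frameMap ξ (EuclideanSpace.single j ζ) = ζ • ξ j := by
  rw [frameMap_apply, Finset.sum_eq_single j]
  · simp
  · intro b _ hb
    simp [hb]
  · simp

theorem continuous_frameMap (ξ : Fin d → Cn d) : Continuous (frameMap ξ) :=
  (frameMap ξ).continuous_of_finiteDimensional

theorem dil_smul_rpow (w : Fin d → ℝ) {s : ℝ} (hs : 0 < s) (a : ℝ) (z : Cn d) :
    s ^ a • dil w s z = dil (fun j => a + w j) s z := by
  ext j
  simp only [PiLp.smul_apply, dil_apply, Real.rpow_add hs, Complex.real_smul]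
  push_cast
  ring

theorem tendsto_dil {T : Type*} {l : Filter T} {w : Fin d → ℝ} (hw : ∀ j, 0 < w j) {s : T → ℝ}
    {z : T → Cn d} {z₀ : Cn d} (hs : Tendsto s l (𝓝[>] 0)) (hz : Tendsto z l (𝓝 z₀)) :
    Tendsto (fun t => dil w (s t) (z t)) l (𝓝 0) := by
  have h : Tendsto (fun t => fun j => ((s t ^ w j : ℝ) : ℂ) * z t j) l (𝓝 (0 : Fin d → ℂ)) := by
    refine tendsto_pi_nhds.2 fun j => ?_
    have h1 : Tendsto (fun t => ((s t ^ w j : ℝ) : ℂ)) l (𝓝 ((0 : ℝ) : ℂ)) :=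
      (Complex.continuous_ofReal.tendsto _).comp ((tendsto_rpow_nhdsGT_zero (hw j)).comp hs)
    have h2 : Tendsto (fun t => z t j) l (𝓝 (z₀ j)) :=
      ((EuclideanSpace.proj j : Cn d →L[ℂ] ℂ).continuous.tendsto z₀).comp hz
    simpa using h1.mul h2
  have h3 := ((PiLp.continuous_toLp 2 (fun _ : Fin d => ℂ)).tendsto 0).comp h
  rw [WithLp.toLp_zero] at h3
  exact h3

/-- The weights `1 / mⱼ`. -/
noncomputable def invWeight (m : Fin d → ℕ) (j : Fin d) : ℝ := 1 / (m j : ℝ)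

/-- The model function: the part of weight `1` of a polynomial, `zⱼ` having weight `1 / mⱼ`. -/
noncomputable def modelPart (m : Fin d → ℕ) (q : MvPolynomial (Fin d ⊕ Fin d) ℝ) (z : Cn d) : ℝ :=
  polyFun (weightComponent (Sum.elim (invWeight m) (invWeight m)) 1 q) z

theorem isRealPolynomial_modelPart (m : Fin d → ℕ) (q : MvPolynomial (Fin d ⊕ Fin d) ℝ) :
    IsRealPolynomial (modelPart m q) := ⟨_, fun _ => rfl⟩

theorem continuous_modelPart (m : Fin d → ℕ) (q : MvPolynomial (Fin d ⊕ Fin d) ℝ) :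
    Continuous (modelPart m q) := continuous_polyFun _

theorem modelPart_dil (m : Fin d → ℕ) (q : MvPolynomial (Fin d ⊕ Fin d) ℝ) {t : ℝ} (ht : 0 < t)
    (z : Cn d) : modelPart m q (dil (invWeight m) t z) = t * modelPart m q z := by
  rw [modelPart, polyFun, realCoord_dil, eval_dilate_weightComponent _ _ _ ht, Real.rpow_one]
  rfl

theorem isWeightedHomogeneous_modelPart (m : Fin d → ℕ) (q : MvPolynomial (Fin d ⊕ Fin d) ℝ) :
    IsWeightedHomogeneous m (modelPart m q) := fun _ ht z => modelPart_dil m q ht z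

theorem modelPart_zero (m : Fin d → ℕ) (q : MvPolynomial (Fin d ⊕ Fin d) ℝ) :
    modelPart m q 0 = 0 := by
  have h := modelPart_dil m q two_pos 0
  have : dil (invWeight m) 2 (0 : Cn d) = 0 := by ext j; simp [dil_apply]
  rw [this] at h
  linarith

/-! ### Convergence of the anisotropic rescalings to the model function -/

section Adapted

variable {f : Cn d → ℝ} {p q : MvPolynomial (Fin d ⊕ Fin d) ℝ} {N : ℕ} {ρ : ℝ} {m : Fin d → ℕ}
  {W : ℕ → Submodule ℂ (Cn d)} {ξ : Fin d → Cn d}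

theorem invWeight_pos (had : IsAdapted f p m W ξ) (j : Fin d) : 0 < invWeight m j := by
  have : 0 < m j := Nat.pos_of_ne_zero (had.ne_zero j)
  rw [invWeight]
  positivity

/-- If i ≤ j and m_j < m_i, then ξ_j ∈ W_j ⊆ W_i has order greater than m_j, so the part of degree
m_j vanishes at ξ_j, where it should be at least 1. -/
theorem monotone_of_isAdapted (hf : IsConvexGerm f ρ)
    (hp : (fun z => f z - polyFun p z) =O[𝓝 0] fun z => ‖z‖ ^ N) (hN : ∀ j, m j < N)
    (had : IsAdapted f p m W ξ) : Monotone m := by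
  intro i j hij
  by_contra! hlt
  have h1 : ((m j + 1 : ℕ) : ℕ∞) ≤ ord f (ξ j) :=
    le_trans (by exact_mod_cast hlt) (had.le_ord i _ (had.anti hij (had.mem j)))
  have h2 := homPart_eq_zero_of_succ_le_ord hf.contDiffAt hp h1 (hN j) 1
  have h3 := had.one_le j 0 (Submodule.zero_mem _)
  rw [one_smul] at h2
  rw [add_zero, h2] at h3
  linarith

theorem frameMap_mem (had : IsAdapted f p m W ξ) {k : ℕ} {z : Cn d}
    (hz : ∀ l : Fin d, (l : ℕ) < k → z l = 0) : frameMap ξ z ∈ W k := by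
  rw [frameMap_apply]
  refine Submodule.sum_mem _ fun l _ => ?_
  by_cases hl : (l : ℕ) < k
  · simp [hz l hl]
  · exact Submodule.smul_mem _ _ (had.anti (not_lt.1 hl) (had.mem l))

/-- The frame sends such a z into ξ_j + W_{j+1}. -/
theorem one_le_homPart_frameMap (had : IsAdapted f p m W ξ) {j : Fin d} {z : Cn d}
    (hz : ∀ l < j, z l = 0) (hj : z j = 1) : 1 ≤ homPart (m j) p (frameMap ξ z) := by
  have h1 : frameMap ξ (z - EuclideanSpace.single j 1) ∈ W (j + 1) := by
    refine frameMap_mem had fun l hl => ?_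
    rcases lt_or_eq_of_le (Nat.lt_succ_iff.1 hl) with h | h
    · have : l < j := h
      simp [hz l this, this.ne]
    · have : l = j := Fin.ext h
      simp [this, hj]
  have h2 := had.one_le j _ h1
  rwa [map_sub, frameMap_single, one_smul, add_sub_cancel] at h2

theorem homPart_smul_lt_one (had : IsAdapted f p m W ξ) {j : Fin d} {ζ : ℂ} (hζ : ‖ζ‖ < 1) :
    homPart (m j) p (ζ • ξ j) < 1 := by
  have hξ : ξ j ≠ 0 := by
    intro h
    have h3 := had.one_le j 0 (Submodule.zero_mem _)
    rw [add_zero, h, homPart_zero (had.ne_zero j)] at h3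
    linarith
  refine had.lt_one j _ (Submodule.smul_mem _ _ (had.mem j)) ?_
  rw [norm_smul]
  exact mul_lt_of_lt_one_left (norm_pos_iff.2 hξ) hζ

theorem exists_first_ne_zero {z : Cn d} (hz : z ≠ 0) : ∃ j, z j ≠ 0 ∧ ∀ l < j, z l = 0 := by
  have hne : (Finset.univ.filter fun j => z j ≠ 0).Nonempty := by
    by_contra h
    rw [Finset.not_nonempty_iff_eq_empty, Finset.filter_eq_empty_iff] at h
    exact hz (by ext j; simpa using h (Finset.mem_univ j))
  obtain ⟨j, hj, hmin⟩ := Finset.exists_min_image _ id hne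
  simp only [Finset.mem_filter, Finset.mem_univ, true_and, id] at hj hmin
  refine ⟨j, hj, fun l hl => ?_⟩
  by_contra hne
  exact absurd (hmin l hne) (not_le.2 hl)

/-- A nonzero vector of the kernel, scaled so that its first nonzero coordinate is 1, would give a
leading term at least 1 at the origin, where it is 0. -/
theorem frameMap_injective (had : IsAdapted f p m W ξ) : Function.Injective (frameMap ξ) := by
  rw [← LinearMap.ker_eq_bot, LinearMap.ker_eq_bot']
  intro z hz
  by_contra hne
  obtain ⟨j, hj, hlow⟩ := exists_first_ne_zero hne
  have h1 := one_le_homPart_frameMap had (j := j) (z := (z j)⁻¹ • z)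
    (fun l hl => by simp [hlow l hl]) (by simp [hj])
  rw [map_smul, hz, smul_zero, homPart_zero (had.ne_zero j)] at h1
  linarith

/-- Along the anisotropic dilations `f` is `O(s)`: this is where convexity excludes mixed terms. -/
theorem isBigO_dil (hf : IsConvexGerm f ρ) (had : IsAdapted f p m W ξ) (z : Cn d) :
    (fun s : ℝ => f (frameMap ξ (dil (invWeight m) s z))) =O[𝓝[>] 0] fun s => s ^ (1 : ℝ) := by
  rcases Nat.eq_zero_or_pos d with rfl | hd
  · have : ∀ s, frameMap ξ (dil (invWeight m) s z) = 0 := fun s => Subsingleton.elim _ _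
    simp only [this, hf.map_zero]
    exact isBigO_zero _ _
  have hd' : (0 : ℝ) < d := by exact_mod_cast hd
  -- The factor d makes the image of the dilated point the average of the d points `c j s • ξ j`, to
  -- which Jensen's inequality applies; each has an f-value O(s), as (s^(1/m_j))^m_j = s.
  let c : Fin d → ℝ → ℂ := fun j s => (d : ℂ) * (((s ^ invWeight m j : ℝ) : ℂ) * z j)
  have hc : ∀ j, Tendsto (c j) (𝓝[>] 0) (𝓝 0) := by
    intro j
    have h1 : Tendsto (fun s : ℝ => ((s ^ invWeight m j : ℝ) : ℂ)) (𝓝[>] 0) (𝓝 ((0 : ℝ) : ℂ)) :=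
      (Complex.continuous_ofReal.tendsto _).comp (tendsto_rpow_nhdsGT_zero (invWeight_pos had j))
    simpa using (h1.mul_const (z j)).const_mul (d : ℂ)
  have hterm : ∀ j, (fun s : ℝ => f (c j s • ξ j)) =O[𝓝[>] 0] fun s => s ^ (1 : ℝ) := by
    intro j
    refine ((isBigO_of_le_ord hf.contDiffAt (had.le_ord j _ (had.mem j))).comp_tendsto
      (hc j)).trans ?_
    refine IsBigO.of_bound ((d * ‖z j‖) ^ m j) ?_
    filter_upwards [self_mem_nhdsWithin] with s hs
    have hs : 0 < s := hs
    have hm0 : (m j : ℝ) ≠ 0 := by exact_mod_cast had.ne_zero j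
    have e : (s ^ invWeight m j) ^ m j = s := by
      rw [← Real.rpow_natCast, ← Real.rpow_mul hs.le, invWeight, one_div, inv_mul_cancel₀ hm0,
        Real.rpow_one]
    simp only [Function.comp, c, norm_pow, norm_norm, norm_mul, Complex.norm_real,
      Complex.norm_natCast, mul_pow, Real.rpow_one]
    rw [← norm_pow (s ^ invWeight m j), e, Real.norm_of_nonneg hd'.le]
    exact le_of_eq (by ring)
  have hsum : (fun s : ℝ => ∑ j, (1 / (d : ℝ)) * f (c j s • ξ j)) =O[𝓝[>] 0]
      fun s => s ^ (1 : ℝ) := IsBigO.fun_sum fun j _ => (hterm j).const_mul_left _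
  have hball : ∀ᶠ s : ℝ in 𝓝[>] 0, ∀ j, c j s • ξ j ∈ Metric.ball (0 : Cn d) ρ := by
    refine eventually_all.2 fun j => ?_
    have : Tendsto (fun s => c j s • ξ j) (𝓝[>] 0) (𝓝 0) := by
      simpa using (hc j).smul_const (ξ j)
    exact this.eventually (Metric.ball_mem_nhds _ hf.pos)
  refine IsBigO.trans (IsBigO.of_bound 1 ?_) hsum
  filter_upwards [hball] with s hs
  have e : frameMap ξ (dil (invWeight m) s z) = ∑ j, (1 / (d : ℝ)) • (c j s • ξ j) := by
    rw [frameMap_apply]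
    refine Finset.sum_congr rfl fun j _ => ?_
    rw [dil_apply, ← Complex.coe_smul, smul_smul]
    congr 1
    have : (d : ℂ) ≠ 0 := by exact_mod_cast hd.ne'
    simp only [c]
    push_cast
    field_simp
  have hone : ∑ _j : Fin d, (1 / (d : ℝ)) = 1 := by
    simp [hd'.ne']
  have hle := hf.convexOn.map_sum_le (t := Finset.univ) (w := fun _ : Fin d => 1 / (d : ℝ))
    (p := fun j => c j s • ξ j) (fun _ _ => by positivity) hone (fun j _ => hs j)
  have hmem := hf.convexOn.1.sum_mem (t := Finset.univ) (w := fun _ : Fin d => 1 / (d : ℝ))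
    (z := fun j => c j s • ξ j) (fun _ _ => by positivity) hone (fun j _ => hs j)
  rw [← e] at hle hmem
  have h0 := hf.nonneg _ hmem
  rw [one_mul, Real.norm_of_nonneg h0]
  refine le_trans (by simpa using hle) (le_trans (le_abs_self _) (le_of_eq ?_))
  simp

/-- Write s⁻¹ ‖δ_s z‖^N = ‖s^(-1/N) δ_s z‖^N. This is a dilation with weights 1/m_j - 1/N, positive
because N > m_j. -/
theorem tendsto_remainder_dil (had : IsAdapted f p m W ξ) (hN : ∀ j, m j < N) {F : Cn d → ℝ}
    (hF : F =O[𝓝 0] fun z => ‖z‖ ^ N)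
    {T : Type*} {l : Filter T} {s : T → ℝ} {z : T → Cn d} {z₀ : Cn d}
    (hs : Tendsto s l (𝓝[>] 0)) (hz : Tendsto z l (𝓝 z₀)) (hN0 : N ≠ 0) :
    Tendsto (fun t => s t ^ (-1 : ℝ) * F (dil (invWeight m) (s t) (z t))) l (𝓝 0) := by
  have hNpos : (0 : ℝ) < N := by exact_mod_cast Nat.pos_of_ne_zero hN0
  have h1 := hF.comp_tendsto (tendsto_dil (invWeight_pos had) hs hz)
  have h2 := (isBigO_refl (fun t => s t ^ (-1 : ℝ)) l).mul h1
  have h3 : Tendsto (fun t => ‖dil (fun j => -(1 / (N : ℝ)) + invWeight m j) (s t) (z t)‖ ^ N) l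
      (𝓝 0) := by
    have h4 : ∀ j, 0 < -(1 / (N : ℝ)) + invWeight m j := by
      intro j
      have hmj : (0 : ℝ) < m j := by exact_mod_cast Nat.pos_of_ne_zero (had.ne_zero j)
      have : 1 / (N : ℝ) < 1 / (m j : ℝ) :=
        one_div_lt_one_div_of_lt hmj (by exact_mod_cast hN j)
      rw [invWeight]
      linarith
    have := (tendsto_dil h4 hs hz).norm.pow N
    simpa [hN0] using this
  refine (h2.congr' EventuallyEq.rfl ?_).trans_tendsto h3
  filter_upwards [hs.eventually self_mem_nhdsWithin] with t ht
  have ht : 0 < s t := ht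
  rw [← dil_smul_rpow _ ht, norm_smul, mul_pow, Real.norm_of_nonneg (Real.rpow_nonneg ht.le _),
    ← Real.rpow_natCast (s t ^ (-(1 / (N : ℝ)))), ← Real.rpow_mul ht.le]
  simp only [Function.comp]
  congr 2
  field_simp

/-- Anisotropic rescalings of `f` converge to the model function. -/
theorem tendsto_modelPart (hf : IsConvexGerm f ρ) (had : IsAdapted f p m W ξ) (hN : ∀ j, m j < N)
    (hN0 : N ≠ 0) (hq : (fun z => f (frameMap ξ z) - polyFun q z) =O[𝓝 0] fun z => ‖z‖ ^ N)
    {T : Type*} {l : Filter T} {s : T → ℝ} {z : T → Cn d} {z₀ : Cn d}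
    (hs : Tendsto s l (𝓝[>] 0)) (hz : Tendsto z l (𝓝 z₀)) :
    Tendsto (fun t => s t ^ (-1 : ℝ) * f (frameMap ξ (dil (invWeight m) (s t) (z t)))) l
      (𝓝 (modelPart m q z₀)) := by
  -- The Taylor polynomial inherits the bound O(s) along every orbit, so its components of weight <
  -- 1 vanish at every point. This is why z may vary together with s.
  have hlow : ∀ y : Cn d, (fun s : ℝ => MvPolynomial.eval
      (dilate (Sum.elim (invWeight m) (invWeight m)) s (realCoord y)) q) =O[𝓝[>] 0]
      fun s => s ^ (1 : ℝ) := by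
    intro y
    have h1 := tendsto_remainder_dil had hN hq (l := 𝓝[>] 0) (s := fun s => s) (z := fun _ => y)
      tendsto_id tendsto_const_nhds hN0
    have h2 := (isBigO_refl (fun s : ℝ => s ^ (1 : ℝ)) (𝓝[>] 0)).mul (h1.isBigO_one ℝ)
    have h3 : (fun s : ℝ => f (frameMap ξ (dil (invWeight m) s y)) -
        polyFun q (dil (invWeight m) s y)) =O[𝓝[>] 0] fun s => s ^ (1 : ℝ) := by
      refine h2.congr' ?_ (by simp)
      filter_upwards [self_mem_nhdsWithin] with s hs
      rw [← mul_assoc, ← Real.rpow_add hs]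
      simp
    refine ((isBigO_dil hf had y).sub h3).congr_left fun s => ?_
    rw [sub_sub_cancel, polyFun, realCoord_dil]
  have h1 := tendsto_eval_dilate (κ := 1) (p := q) hs
    ((continuous_realCoord.tendsto z₀).comp hz)
    (fun t k hk => eval_weightComponent_eq_zero (hlow (z t)) hk)
  have h2 := h1.add (tendsto_remainder_dil had hN hq hs hz hN0)
  rw [add_zero] at h2
  refine h2.congr fun t => ?_
  simp only [Function.comp]
  rw [← realCoord_dil, ← mul_add, polyFun, add_sub_cancel]

theorem contDiffAt_comp_frameMap (hf : IsConvexGerm f ρ) (ξ : Fin d → Cn d) :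
    ContDiffAt ℝ ∞ (fun z => f (frameMap ξ z)) 0 := by
  have h : ContDiff ℝ ∞ (frameMap ξ) := by
    have := ((frameMap ξ).toContinuousLinearMap.restrictScalars ℝ).contDiff (n := ∞)
    exact this
  exact ContDiffAt.comp (0 : Cn d) (g := f) (by simpa using hf.contDiffAt) h.contDiffAt

theorem eventually_dil_mem_ball (had : IsAdapted f p m W ξ) (hρ : 0 < ρ) (z : Cn d) :
    ∀ᶠ s : ℝ in 𝓝[>] 0, frameMap ξ (dil (invWeight m) s z) ∈ Metric.ball (0 : Cn d) ρ := by
  have h1 := ((continuous_frameMap ξ).tendsto 0).comp (tendsto_dil (invWeight_pos had)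
    (l := 𝓝[>] 0) (s := fun s => s) (z := fun _ => z) tendsto_id tendsto_const_nhds)
  rw [map_zero] at h1
  exact h1.eventually (Metric.ball_mem_nhds _ hρ)

theorem modelPart_nonneg (hf : IsConvexGerm f ρ) (had : IsAdapted f p m W ξ) (hN : ∀ j, m j < N)
    (hN0 : N ≠ 0) (hq : (fun z => f (frameMap ξ z) - polyFun q z) =O[𝓝 0] fun z => ‖z‖ ^ N)
    (z : Cn d) : 0 ≤ modelPart m q z := by
  refine ge_of_tendsto (tendsto_modelPart hf had hN hN0 hq (l := 𝓝[>] 0) (s := fun s => s)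
    (z := fun _ => z) tendsto_id tendsto_const_nhds) ?_
  filter_upwards [eventually_dil_mem_ball had hf.pos z, self_mem_nhdsWithin] with s h1 hs
  exact mul_nonneg (Real.rpow_nonneg (le_of_lt hs) _) (hf.nonneg _ h1)

theorem dil_combination (w : Fin d → ℝ) (s a b : ℝ) (x y : Cn d) :
    dil w s (a • x + b • y) = a • dil w s x + b • dil w s y := by
  ext j
  simp only [dil_apply, PiLp.add_apply, PiLp.smul_apply, Complex.real_smul]
  ring

theorem modelPart_convexOn (hf : IsConvexGerm f ρ) (had : IsAdapted f p m W ξ) (hN : ∀ j, m j < N)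
    (hN0 : N ≠ 0) (hq : (fun z => f (frameMap ξ z) - polyFun q z) =O[𝓝 0] fun z => ‖z‖ ^ N) :
    ConvexOn ℝ univ (modelPart m q) := by
  have hlim := fun z : Cn d => tendsto_modelPart hf had hN hN0 hq (l := 𝓝[>] 0) (s := fun s => s)
    (z := fun _ => z) tendsto_id tendsto_const_nhds
  refine ⟨convex_univ, fun u _ v _ a b ha hb hab => ?_⟩
  refine le_of_tendsto_of_tendsto (hlim _) (((hlim u).const_smul a).add ((hlim v).const_smul b)) ?_
  filter_upwards [eventually_dil_mem_ball had hf.pos u, eventually_dil_mem_ball had hf.pos v,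
    self_mem_nhdsWithin] with s h1 h2 hs
  have h3 := hf.convexOn.2 h1 h2 ha hb hab
  have hR : ∀ (a : ℝ) (x : Cn d), frameMap ξ (a • x) = a • frameMap ξ x := fun a x => by
    rw [← Complex.coe_smul, map_smul, Complex.coe_smul]
  rw [dil_combination, map_add, hR, hR]
  simp only [smul_eq_mul] at h3 ⊢
  have h4 : 0 ≤ s ^ (-1 : ℝ) := Real.rpow_nonneg (le_of_lt hs) _
  nlinarith [mul_le_mul_of_nonneg_left h3 h4]

/-- On a block of coordinates of equal weight the model function is the leading term of `f`. -/
theorem modelPart_eq_homPart (hf : IsConvexGerm f ρ) (had : IsAdapted f p m W ξ)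
    (hN : ∀ j, m j < N) (hp : (fun z => f z - polyFun p z) =O[𝓝 0] fun z => ‖z‖ ^ N)
    (hq : (fun z => f (frameMap ξ z) - polyFun q z) =O[𝓝 0] fun z => ‖z‖ ^ N) {j : Fin d}
    {z : Cn d} (hz : ∀ l < j, z l = 0) (hz' : ∀ l, m l ≠ m j → z l = 0) :
    modelPart m q z = homPart (m j) p (frameMap ξ z) := by
  have hN0 : N ≠ 0 := by have := hN j; lia
  have h1 := tendsto_modelPart hf had hN hN0 hq (l := 𝓝[>] 0) (s := fun s => s)
    (z := fun _ => z) tendsto_id tendsto_const_nhds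
  have hm0 : (m j : ℝ) ≠ 0 := by exact_mod_cast had.ne_zero j
  -- On the block the dilation is multiplication by σ = s^(1/m_j), and σ^(-m_j) = s⁻¹: both sides
  -- are limits of the same family.
  have hσ : Tendsto (fun s : ℝ => s ^ invWeight m j) (𝓝[>] 0) (𝓝[>] 0) :=
    tendsto_nhdsWithin_iff.2 ⟨tendsto_rpow_nhdsGT_zero (invWeight_pos had j), by
      filter_upwards [self_mem_nhdsWithin] with s hs using Real.rpow_pos_of_pos hs _⟩
  have h2 := (tendsto_homPart hf.contDiffAt hp
    (had.le_ord j _ (frameMap_mem had (k := j) (z := z) hz)) (hN j)).comp hσ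
  refine tendsto_nhds_unique h1 (h2.congr' ?_)
  filter_upwards [self_mem_nhdsWithin] with s hs
  have hs : 0 < s := hs
  have e1 : dil (invWeight m) s z = s ^ invWeight m j • z := by
    ext l
    rw [dil_apply, PiLp.smul_apply, Complex.real_smul]
    by_cases hl : m l = m j
    · rw [invWeight, invWeight, hl]
    · simp [hz' l hl]
  simp only [Function.comp]
  rw [e1, ← Real.rpow_mul hs.le, ← Complex.coe_smul, ← Complex.coe_smul, map_smul]
  congr 2
  rw [invWeight]
  field_simp

/-- A monomial of weight `1` in the variables of weight at most `1 / k` is not linear in the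
variables of weight smaller than `1 / k`. -/
theorem sum_heavy_ne_one {ι : Type*} [Fintype ι] {w : ι → ℝ} {α : ι →₀ ℕ} {k : ℕ} (hk : k ≠ 0)
    (hwpos : ∀ i, 0 < w i) (hα : ∀ i, α i ≠ 0 → w i ≤ 1 / k) (hw : weight w α = 1) :
    ∑ i with w i ≠ 1 / k, α i ≠ 1 := by
  intro h1
  have hk' : (0 : ℝ) < k := by exact_mod_cast Nat.pos_of_ne_zero hk
  -- If the total degree in the variables of smaller weight were 1, their contribution S would
  -- satisfy 0 < S < 1/k. The remaining variables contribute n/k, so the integer n = k - kS would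
  -- lie strictly between k - 1 and k.
  set S : ℝ := ∑ i with w i ≠ 1 / k, w i * α i
  obtain ⟨i₀, hi₀, hαi₀⟩ : ∃ i ∈ Finset.univ.filter (fun i => w i ≠ 1 / (k : ℝ)), α i ≠ 0 := by
    by_contra! h
    rw [Finset.sum_eq_zero h] at h1
    exact absurd h1 (by norm_num)
  have hS0 : 0 < S := by
    refine Finset.sum_pos' (fun i _ => mul_nonneg (hwpos i).le (Nat.cast_nonneg _))
      ⟨i₀, hi₀, mul_pos (hwpos i₀) ?_⟩
    exact_mod_cast Nat.pos_of_ne_zero hαi₀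
  have hS1 : S < 1 / k := by
    have h2 : S < ∑ i with w i ≠ 1 / (k : ℝ), 1 / (k : ℝ) * α i := by
      refine Finset.sum_lt_sum (fun i _ => ?_) ⟨i₀, hi₀, ?_⟩
      · by_cases h : α i = 0
        · simp [h]
        · have := hα i h
          gcongr
      · have h3 : w i₀ < 1 / k := lt_of_le_of_ne (hα i₀ hαi₀) (Finset.mem_filter.1 hi₀).2
        have h4 : (0 : ℝ) < α i₀ := by exact_mod_cast Nat.pos_of_ne_zero hαi₀
        exact mul_lt_mul_of_pos_right h3 h4
    rw [← Finset.mul_sum, ← Nat.cast_sum, h1] at h2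
    simpa using h2
  have hsplit : (∑ i with w i = 1 / (k : ℝ), w i * α i) + S = 1 := by
    rw [Finset.sum_filter_add_sum_filter_not Finset.univ (fun i => w i = 1 / (k : ℝ))]
    exact hw
  have hlow : ∑ i with w i = 1 / (k : ℝ), w i * α i =
      1 / k * ((∑ i with w i = 1 / (k : ℝ), α i : ℕ) : ℝ) := by
    rw [Nat.cast_sum, Finset.mul_sum]
    exact Finset.sum_congr rfl fun i hi => by rw [(Finset.mem_filter.1 hi).2]
  set n := ∑ i with w i = 1 / (k : ℝ), α i
  rw [hlow] at hsplit
  have h5 : (n : ℝ) = k - k * S := by field_simp at hsplit; linarith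
  have h6 : (n : ℝ) < k := by rw [h5]; have := mul_pos hk' hS0; linarith
  have h7 : (k : ℝ) < n + 1 := by
    rw [h5]
    rw [lt_div_iff₀ hk'] at hS1
    linarith
  have h8 : n < k := by exact_mod_cast h6
  have h9 : k < n + 1 := by exact_mod_cast h7
  lia

/-- The model function does not increase when the coordinates of smaller weight are dropped. -/
theorem modelPart_truncate_le (hm : Monotone m) (hm0 : ∀ j, m j ≠ 0)
    (hconv : ConvexOn ℝ univ (modelPart m q)) {j : Fin d} {z : Cn d} (hz : ∀ l < j, z l = 0) :
    modelPart m q (WithLp.toLp 2 fun l => if m l = m j then z l else 0) ≤ modelPart m q z := by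
  -- Coordinates outside the block are multiplied by σ: y(1) = z and y(0) is the truncation. No
  -- monomial that is nonzero at z is linear in σ, so the convex function P(y(σ)) has derivative 0
  -- at σ = 0 and its minimum there.
  let y : ℝ → Cn d := fun σ => WithLp.toLp 2 fun l => if m l = m j then z l else (σ : ℂ) * z l
  set w : Fin d ⊕ Fin d → ℝ := Sum.elim (invWeight m) (invWeight m) with hwdef
  have hmpos : ∀ l, (0 : ℝ) < m l := fun l => by exact_mod_cast Nat.pos_of_ne_zero (hm0 l)
  have hwiff : ∀ l, invWeight m l = 1 / (m j : ℝ) ↔ m l = m j := by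
    intro l
    rw [invWeight, one_div, one_div, inv_inj, Nat.cast_inj]
  have hwpos : ∀ i, 0 < w i := by
    rintro (l | l) <;> simp only [hwdef, Sum.elim_inl, Sum.elim_inr, invWeight] <;>
      exact one_div_pos.2 (hmpos l)
  have hcoord : ∀ σ i, realCoord (y σ) i =
      (if w i = 1 / (m j : ℝ) then 1 else σ) * realCoord z i := by
    rintro σ (l | l) <;>
    · simp only [realCoord, hwdef, Sum.elim_inl, Sum.elim_inr, hwiff, y]
      split_ifs <;> simp
  have hpoly : ∀ σ, modelPart m q (y σ) = ∑ α ∈ q.support with weight w α = 1,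
      σ ^ (∑ i with w i ≠ 1 / (m j : ℝ), α i) * (q.coeff α * ∏ i, realCoord z i ^ α i) := by
    intro σ
    rw [modelPart, polyFun, eval_weightComponent]
    refine Finset.sum_congr rfl fun α _ => ?_
    simp only [hcoord, mul_pow, Finset.prod_mul_distrib]
    have : ∏ i, (if w i = 1 / (m j : ℝ) then (1 : ℝ) else σ) ^ α i =
        σ ^ (∑ i with w i ≠ 1 / (m j : ℝ), α i) := by
      rw [← Finset.prod_pow_eq_pow_sum, Finset.prod_filter]
      refine Finset.prod_congr rfl fun i _ => ?_
      by_cases h : w i = 1 / (m j : ℝ) <;> simp [h]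
    rw [this]
    ring
  have hder : HasDerivAt (fun σ => modelPart m q (y σ)) 0 0 := by
    simp only [hpoly]
    have : (0 : ℝ) = ∑ α ∈ q.support with weight w α = 1, (0 : ℝ) := by simp
    rw [this]
    refine HasDerivAt.fun_sum fun α hα => ?_
    rw [← this]
    by_cases hprod : ∏ i, realCoord z i ^ α i = 0
    · simp only [hprod, mul_zero]
      exact hasDerivAt_const _ _
    · have hK : ∑ i with w i ≠ 1 / (m j : ℝ), α i ≠ 1 := by
        refine sum_heavy_ne_one (hm0 j) hwpos (fun i hi => ?_) (Finset.mem_filter.1 hα).2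
        have hzi : realCoord z i ≠ 0 := by
          intro h0
          exact hprod (Finset.prod_eq_zero (Finset.mem_univ i) (by rw [h0, zero_pow hi]))
        -- Since z starts at the index j and m is monotone, only variables of weight at most 1/m_j
        -- matter.
        have hle : ∀ l, z l ≠ 0 → invWeight m l ≤ 1 / (m j : ℝ) := by
          intro l hl
          have : j ≤ l := by
            by_contra h
            exact hl (hz l (not_le.1 h))
          exact one_div_le_one_div_of_le (hmpos j) (by exact_mod_cast hm this)
        rcases i with l | l <;>
        · simp only [realCoord, Sum.elim_inl, Sum.elim_inr] at hzi
          refine hle l fun h0 => hzi ?_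
          rw [h0]
          simp
      have h1 := (hasDerivAt_pow (∑ i with w i ≠ 1 / (m j : ℝ), α i) (0 : ℝ)).mul_const
        (q.coeff α * ∏ i, realCoord z i ^ α i)
      convert! h1 using 1
      rcases Nat.eq_zero_or_pos (∑ i with w i ≠ 1 / (m j : ℝ), α i) with h0 | h0
      · rw [h0]; simp
      · rw [zero_pow (by lia)]; simp
  have hψ : ConvexOn ℝ univ (fun σ => modelPart m q (y σ)) := by
    refine ⟨convex_univ, fun σ _ τ _ a b ha hb hab => ?_⟩
    have e : y (a • σ + b • τ) = a • y σ + b • y τ := by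
      ext l
      simp only [y, PiLp.add_apply, PiLp.smul_apply, smul_eq_mul, Complex.real_smul]
      split_ifs
      · rw [← add_mul, ← Complex.ofReal_add, hab]; simp
      · push_cast; ring
    change modelPart m q (y _) ≤ _
    rw [e]
    exact hconv.2 (mem_univ _) (mem_univ _) ha hb hab
  have hmin := hψ.isMinOn_of_rightDeriv_eq_zero (x := 0) (by simp)
    (hder.hasDerivWithinAt.derivWithin (uniqueDiffWithinAt_Ioi 0))
  have h01 : modelPart m q (y 0) ≤ modelPart m q (y 1) := hmin (mem_univ 1)
  simpa [y] using h01

theorem modelPart_single_lt_one (hf : IsConvexGerm f ρ) (had : IsAdapted f p m W ξ)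
    (hN : ∀ j, m j < N) (hp : (fun z => f z - polyFun p z) =O[𝓝 0] fun z => ‖z‖ ^ N)
    (hq : (fun z => f (frameMap ξ z) - polyFun q z) =O[𝓝 0] fun z => ‖z‖ ^ N) {j : Fin d} {ζ : ℂ}
    (hζ : ‖ζ‖ < 1) : modelPart m q (EuclideanSpace.single j ζ) < 1 := by
  rw [modelPart_eq_homPart hf had hN hp hq (j := j), frameMap_single]
  · exact homPart_smul_lt_one had hζ
  · intro l hl
    simp [hl.ne]
  · intro l hl
    have : l ≠ j := by rintro rfl; exact hl rfl
    simp [this]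

/-- Truncation to the block of weight 1/m_j keeps z_j = 1 and does not increase the model function,
which on the block is a leading term bounded below by the choice of the frame. -/
theorem one_le_modelPart (hf : IsConvexGerm f ρ) (had : IsAdapted f p m W ξ)
    (hN : ∀ j, m j < N) (hp : (fun z => f z - polyFun p z) =O[𝓝 0] fun z => ‖z‖ ^ N)
    (hq : (fun z => f (frameMap ξ z) - polyFun q z) =O[𝓝 0] fun z => ‖z‖ ^ N) {j : Fin d}
    {z : Cn d} (hz : ∀ l < j, z l = 0) (hj : z j = 1) : 1 ≤ modelPart m q z := by
  have hN0 : N ≠ 0 := by have := hN j; lia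
  refine le_trans ?_ (modelPart_truncate_le (monotone_of_isAdapted hf hp hN had) had.ne_zero
    (modelPart_convexOn hf had hN hN0 hq) hz)
  rw [modelPart_eq_homPart hf had hN hp hq (j := j)]
  · refine one_le_homPart_frameMap had (fun l hl => ?_) ?_
    · simp [hz l hl]
    · simp [hj]
  · intro l hl
    simp [hz l hl]
  · intro l hl
    simp [hl]

end Adapted

/-! ### The splitting ℂ × ℂ^d -/

/-- The point `(a, z) ∈ ℂ × ℂ^d`. -/
noncomputable def consPt (a : ℂ) (z : Cn d) : Cn (d + 1) :=
  WithLp.toLp 2 (Fin.cons a fun j => z j)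

@[simp] theorem consPt_apply_zero (a : ℂ) (z : Cn d) : consPt a z 0 = a := rfl

@[simp] theorem consPt_apply_succ (a : ℂ) (z : Cn d) (j : Fin d) : consPt a z j.succ = z j := rfl

@[simp] theorem tail_consPt (a : ℂ) (z : Cn d) : tail (consPt a z) = z := rfl

@[simp] theorem tail_apply (w : Cn (d + 1)) (j : Fin d) : tail w j = w j.succ := rfl

theorem consPt_zero_tail (w : Cn (d + 1)) : consPt (w 0) (tail w) = w := by
  ext j
  refine Fin.cases ?_ (fun j => ?_) j <;> simp

theorem ext_zero_tail {v w : Cn (d + 1)} (h0 : v 0 = w 0) (ht : tail v = tail w) : v = w := by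
  rw [← consPt_zero_tail v, ← consPt_zero_tail w, h0, ht]

@[simp] theorem tail_zero : tail (0 : Cn (d + 1)) = 0 := by ext j; simp

@[simp] theorem tail_add (v w : Cn (d + 1)) : tail (v + w) = tail v + tail w := by ext j; simp

@[simp] theorem tail_smul {R : Type*} [SMul R ℂ] (c : R) (w : Cn (d + 1)) :
    tail (c • w) = c • tail w := by ext j; simp

theorem continuous_tail : Continuous (tail (d := d)) := by
  refine (PiLp.continuous_toLp 2 (fun _ : Fin d => ℂ)).comp (continuous_pi fun j => ?_)
  fun_prop

/-! ### The domain as the region above a graph -/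

section Graph

variable {D : Set (Cn (d + 1))} {U V : Set ℝ} {W : Set (Cn d)} {F : ℝ × Cn d → ℝ}

/-- Near `0` the set `D ⊆ {Im w₀ > 0}` is the region above the graph of the smooth function `F`. -/
structure IsGraphNear (D : Set (Cn (d + 1))) (U V : Set ℝ) (W : Set (Cn d))
    (F : ℝ × Cn d → ℝ) : Prop where
  convex : Convex ℝ D
  im_pos : ∀ w ∈ D, 0 < (w 0).im
  zero_mem_closure : 0 ∈ closure D
  isOpen_U : IsOpen U
  zero_mem_U : (0 : ℝ) ∈ U
  isOpen_V : IsOpen V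
  zero_mem_V : (0 : ℝ) ∈ V
  isOpen_W : IsOpen W
  zero_mem_W : (0 : Cn d) ∈ W
  contDiffOn : ContDiffOn ℝ ∞ F (U ×ˢ W)
  mem_iff : ∀ w : Cn (d + 1), (w 0).re ∈ U → (w 0).im ∈ V → tail w ∈ W →
    (w ∈ D ↔ F ((w 0).re, tail w) < (w 0).im)

namespace IsGraphNear

theorem consPt_mem_iff (h : IsGraphNear D U V W F) {x y : ℝ} {z : Cn d} (hx : x ∈ U) (hy : y ∈ V)
    (hz : z ∈ W) : consPt ⟨x, y⟩ z ∈ D ↔ F (x, z) < y :=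
  h.mem_iff (consPt ⟨x, y⟩ z) hx hy hz

theorem contDiffAt (h : IsGraphNear D U V W F) : ContDiffAt ℝ ∞ F (0, 0) :=
  h.contDiffOn.contDiffAt
    ((h.isOpen_U.prod h.isOpen_W).mem_nhds ⟨h.zero_mem_U, h.zero_mem_W⟩)

theorem eventually_mem (h : IsGraphNear D U V W F) :
    ∀ᶠ w : Cn (d + 1) in 𝓝 0, (w 0).re ∈ U ∧ (w 0).im ∈ V ∧ tail w ∈ W := by
  have h0 : Continuous fun w : Cn (d + 1) => w 0 := by fun_prop
  have h1 := (Complex.continuous_re.comp h0).continuousAt.preimage_mem_nhds (x := 0)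
    (h.isOpen_U.mem_nhds (by simpa using h.zero_mem_U))
  have h2 := (Complex.continuous_im.comp h0).continuousAt.preimage_mem_nhds (x := 0)
    (h.isOpen_V.mem_nhds (by simpa using h.zero_mem_V))
  have h3 := continuous_tail.continuousAt.preimage_mem_nhds (x := (0 : Cn (d + 1)))
    (h.isOpen_W.mem_nhds (by simpa using h.zero_mem_W))
  filter_upwards [h1, h2, h3] with w a b c using ⟨a, b, c⟩

/-- If F(0, 0) > 0, points of D could not accumulate at 0; if F(0, 0) < 0, then 0 would belong to D,
against Im w₀ > 0. -/
theorem map_zero (h : IsGraphNear D U V W F) : F (0, 0) = 0 := by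
  refine le_antisymm ?_ ?_
  · by_contra! hpos
    have hc : ContinuousAt (fun w : Cn (d + 1) => F ((w 0).re, tail w) - (w 0).im) 0 := by
      have h0 : Continuous fun w : Cn (d + 1) => w 0 := by fun_prop
      refine ContinuousAt.sub (ContinuousAt.comp (g := F) ?_ ?_) ?_
      · simpa using h.contDiffAt.continuousAt
      · exact ((Complex.continuous_re.comp h0).prodMk continuous_tail).continuousAt
      · exact (Complex.continuous_im.comp h0).continuousAt
    have hev : ∀ᶠ w : Cn (d + 1) in 𝓝 0, 0 < F ((w 0).re, tail w) - (w 0).im :=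
      hc.eventually (lt_mem_nhds (by simpa using hpos))
    obtain ⟨w, hwD, ⟨h1, h2, h3⟩, hw⟩ :=
      ((mem_closure_iff_frequently.1 h.zero_mem_closure).and_eventually
        (h.eventually_mem.and hev)).exists
    have := (h.mem_iff w h1 h2 h3).1 hwD
    linarith
  · by_contra! hneg
    have := h.im_pos 0 ((h.mem_iff 0 (by simpa using h.zero_mem_U) (by simpa using h.zero_mem_V)
      (by simpa using h.zero_mem_W)).2 (by simpa using hneg))
    simp at this

theorem exists_Ioo_subset (h : IsGraphNear D U V W F) : ∃ ε > 0, Ioo (-ε) ε ⊆ V := by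
  obtain ⟨ε, hε, hV⟩ := Metric.isOpen_iff.1 h.isOpen_V 0 h.zero_mem_V
  refine ⟨ε, hε, ?_⟩
  rwa [Real.ball_eq_Ioo, zero_sub, zero_add] at hV

/-- Where F < 0, the point at height F/2 would be in D below the real hyperplane Im w₀ = 0. -/
theorem eventually_nonneg (h : IsGraphNear D U V W F) : ∀ᶠ q in 𝓝 ((0 : ℝ), (0 : Cn d)), 0 ≤ F q := by
  obtain ⟨ε, hε, hV⟩ := h.exists_Ioo_subset
  have h1 : ∀ᶠ q in 𝓝 ((0 : ℝ), (0 : Cn d)), -ε < F q :=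
    h.contDiffAt.continuousAt.eventually (lt_mem_nhds (by rw [h.map_zero]; linarith))
  filter_upwards [h1, (h.isOpen_U.prod h.isOpen_W).mem_nhds ⟨h.zero_mem_U, h.zero_mem_W⟩]
    with q hq hqU
  by_contra! hneg
  have := h.im_pos (consPt ⟨q.1, F q / 2⟩ q.2) ((h.consPt_mem_iff hqU.1
    (hV ⟨by linarith, by linarith⟩) hqU.2).2 (by simp only [Prod.mk.eta]; linarith))
  simp at this
  linarith

/-- The origin is a local minimum of F. Strict differentiability is needed later to compare F at two
moving points. -/
theorem hasStrictFDerivAt (h : IsGraphNear D U V W F) :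
    HasStrictFDerivAt F (0 : ℝ × Cn d →L[ℝ] ℝ) (0, 0) := by
  have h1 : IsLocalMin F (0, 0) := by
    filter_upwards [h.eventually_nonneg] with q hq
    rwa [h.map_zero]
  have h2 := h.contDiffAt.hasStrictFDerivAt (by simp)
  rwa [h1.fderiv_eq_zero] at h2

theorem isConvexGerm (h : IsGraphNear D U V W F) :
    ∃ ρ, IsConvexGerm (fun z => F (0, z)) ρ := by
  obtain ⟨ε, hε, hV⟩ := h.exists_Ioo_subset
  have hι : ContDiffAt ℝ ∞ (fun z : Cn d => ((0 : ℝ), z)) 0 := contDiffAt_const.prodMk contDiffAt_id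
  have hf : ContDiffAt ℝ ∞ (fun z => F (0, z)) 0 :=
    ContDiffAt.comp (0 : Cn d) (g := F) h.contDiffAt hι
  have h1 : ∀ᶠ z : Cn d in 𝓝 0, 0 ≤ F (0, z) := hι.continuousAt.eventually h.eventually_nonneg
  have h2 : ∀ᶠ z : Cn d in 𝓝 0, F (0, z) < ε :=
    hf.continuousAt.eventually (gt_mem_nhds (show F (0, 0) < ε by rw [h.map_zero]; exact hε))
  obtain ⟨ρ, hρ, hb⟩ := Metric.eventually_nhds_iff_ball.1
    (h1.and (h2.and (h.isOpen_W.mem_nhds h.zero_mem_W)))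
  refine ⟨ρ, hf, h.map_zero, hρ, ⟨convex_ball _ _, fun z₁ hz₁ z₂ hz₂ a b ha hb' hab => ?_⟩,
    fun z hz => (hb z hz).1⟩
  by_contra! hlt
  have hz := convex_ball (0 : Cn d) ρ hz₁ hz₂ ha hb' hab
  obtain ⟨p1, l1, w1⟩ := hb _ hz₁
  obtain ⟨p2, l2, w2⟩ := hb _ hz₂
  obtain ⟨-, -, w3⟩ := hb _ hz
  simp only [smul_eq_mul] at hlt
  -- D lies strictly above the graph, so both points are raised by δ, small enough to stay at
  -- heights in V and not to exceed the supposed failure of convexity.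
  obtain ⟨δ, hδ, hδ1, hδ2, hδ3⟩ : ∃ δ > 0, F (0, z₁) + δ < ε ∧ F (0, z₂) + δ < ε ∧
      a * F (0, z₁) + b * F (0, z₂) + δ ≤ F (0, a • z₁ + b • z₂) := by
    refine ⟨min (min ((ε - F (0, z₁)) / 2) ((ε - F (0, z₂)) / 2))
      (F (0, a • z₁ + b • z₂) - (a * F (0, z₁) + b * F (0, z₂))), ?_, ?_, ?_, ?_⟩
    · refine lt_min (lt_min ?_ ?_) ?_ <;> linarith
    · have := (min_le_left (min ((ε - F (0, z₁)) / 2) ((ε - F (0, z₂)) / 2))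
        (F (0, a • z₁ + b • z₂) - (a * F (0, z₁) + b * F (0, z₂)))).trans (min_le_left _ _)
      linarith
    · have := (min_le_left (min ((ε - F (0, z₁)) / 2) ((ε - F (0, z₂)) / 2))
        (F (0, a • z₁ + b • z₂) - (a * F (0, z₁) + b * F (0, z₂)))).trans (min_le_right _ _)
      linarith
    · have := min_le_right (min ((ε - F (0, z₁)) / 2) ((ε - F (0, z₂)) / 2))
        (F (0, a • z₁ + b • z₂) - (a * F (0, z₁) + b * F (0, z₂)))
      linarith
  have hmem : ∀ {z : Cn d}, z ∈ W → 0 ≤ F (0, z) → F (0, z) + δ < ε →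
      consPt ⟨0, F (0, z) + δ⟩ z ∈ D := fun {z} hzW h0 hzε =>
    (h.consPt_mem_iff h.zero_mem_U (hV ⟨by linarith, hzε⟩) hzW).2 (by linarith)
  have hm := h.convex (hmem w1 p1 hδ1) (hmem w2 p2 hδ2) ha hb' hab
  have hy := convex_Ioo (-ε) ε (x := F (0, z₁) + δ) ⟨by linarith, hδ1⟩
    (y := F (0, z₂) + δ) ⟨by linarith, hδ2⟩ ha hb' hab
  simp only [smul_eq_mul] at hy
  have e : a • consPt ⟨0, F (0, z₁) + δ⟩ z₁ + b • consPt ⟨0, F (0, z₂) + δ⟩ z₂ =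
      consPt ⟨0, a * (F (0, z₁) + δ) + b * (F (0, z₂) + δ)⟩ (a • z₁ + b • z₂) := by
    refine ext_zero_tail ?_ (by simp)
    apply Complex.ext <;> simp
  rw [e, h.consPt_mem_iff h.zero_mem_U (hV hy) w3] at hm
  have : a * (F (0, z₁) + δ) + b * (F (0, z₂) + δ) =
      a * F (0, z₁) + b * F (0, z₂) + (a + b) * δ := by ring
  rw [hab, one_mul] at this
  linarith

end IsGraphNear

end Graph

/-! ### Local Hausdorff convergence of sublevel sets -/

/-- Local Hausdorff convergence of sublevel sets under locally uniform convergence to a convex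
function. -/
theorem localHausdorffTendsto_of_sublevel {n : ℕ} {Ds : ℕ → Set (Cn n)} {D : Set (Cn n)}
    {Es : ℕ → Cn n → ℝ} {E : Cn n → ℝ} (hE : Continuous E) (hconv : ConvexOn ℝ univ E)
    (hE0 : E 0 = -1) (hD : D = {w | E w < 0})
    (h : ∀ R δ : ℝ, 0 < δ → ∀ᶠ k in atTop, ∀ w ∈ Metric.closedBall (0 : Cn n) R,
      (w ∈ Ds k ↔ Es k w < 0) ∧ |Es k w - E w| < δ) :
    LocalHausdorffTendsto Ds D := by
  refine ⟨0, le_rfl, fun R hR => ?_⟩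
  rw [ENNReal.tendsto_nhds_zero]
  intro ε hε
  obtain ⟨ε', hε'0, hε'⟩ := ENNReal.lt_iff_exists_nnreal_btwn.1 hε
  have hε'0 : (0 : ℝ) < ε' := by exact_mod_cast hε'0
  -- Shrinking by 1 - η moves points of the ball by at most ηR ≤ ε' and, as E(0) = -1, gives E((1 -
  -- η)w) ≤ (1 - η)E(w) - η. That gain absorbs the error η/2 in either direction.
  set η : ℝ := min (1 / 2) (ε' / (R + 1)) with hη
  have hη0 : 0 < η := by positivity
  have hη1 : η ≤ 1 / 2 := min_le_left _ _
  have hηR : η * R ≤ ε' := by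
    have h1 : η ≤ ε' / (R + 1) := min_le_right _ _
    rw [le_div_iff₀ (by positivity)] at h1
    nlinarith
  have hshrink : ∀ w : Cn n, E ((1 - η) • w) ≤ (1 - η) * E w - η := by
    intro w
    have := hconv.2 (mem_univ w) (mem_univ 0) (by linarith : 0 ≤ 1 - η) hη0.le (by ring)
    simp only [smul_zero, add_zero, hE0, smul_eq_mul] at this
    linarith
  have hnorm : ∀ w ∈ Metric.closedBall (0 : Cn n) R,
      (1 - η) • w ∈ Metric.closedBall (0 : Cn n) R ∧ edist w ((1 - η) • w) ≤ ε := by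
    intro w hw
    have hw : ‖w‖ ≤ R := by simpa using hw
    constructor
    · rw [mem_closedBall_zero_iff, norm_smul, Real.norm_of_nonneg (by linarith)]
      nlinarith [norm_nonneg w]
    · refine le_trans ?_ hε'.le
      rw [edist_dist, dist_eq_norm]
      have : w - (1 - η) • w = η • w := by module
      rw [this, norm_smul, Real.norm_of_nonneg hη0.le]
      refine ENNReal.ofReal_le_of_le_toReal ?_
      rw [ENNReal.coe_toReal]
      nlinarith [norm_nonneg w]
  -- The larger radius is needed because a closure point in the ball of radius R is a limit of
  -- points of `Ds k` that may lie outside that ball.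
  filter_upwards [h (R + 1) (η / 2) (by positivity)] with k hk
  refine Metric.hausdorffEDist_le_of_mem_edist ?_ ?_
  · rintro w ⟨hwD, hwR⟩
    refine ⟨(1 - η) • w, ⟨subset_closure ?_, (hnorm w hwR).1⟩, (hnorm w hwR).2⟩
    have hwE : E w ≤ η / 2 := by
      have hwb : w ∈ Metric.ball (0 : Cn n) (R + 1) := by
        have : ‖w‖ ≤ R := by simpa using hwR
        rw [mem_ball_zero_iff]
        linarith
      have hcl := Metric.isOpen_ball.inter_closure ⟨hwb, hwD⟩
      have hsub : Metric.ball (0 : Cn n) (R + 1) ∩ Ds k ⊆ {w | E w ≤ η / 2} := by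
        rintro v ⟨hv, hvD⟩
        obtain ⟨h1, h2⟩ := hk v (Metric.ball_subset_closedBall hv)
        have h3 := h1.1 hvD
        have h4 := (abs_lt.1 h2).1
        change E v ≤ η / 2
        linarith
      exact closure_minimal hsub (isClosed_le hE continuous_const) hcl
    rw [hD]
    have := hshrink w
    change E _ < 0
    nlinarith
  · rintro w ⟨hwD, hwR⟩
    refine ⟨(1 - η) • w, ⟨subset_closure ?_, (hnorm w hwR).1⟩, (hnorm w hwR).2⟩
    have hwE : E w ≤ 0 := by
      refine closure_minimal ?_ (isClosed_le hE continuous_const) hwD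
      rw [hD]
      intro v hv
      exact (show E v < 0 from hv).le
    obtain ⟨h1, h2⟩ := hk _ (Metric.closedBall_subset_closedBall (by linarith) (hnorm w hwR).1)
    rw [h1]
    have h3 := hshrink w
    have h4 := (abs_lt.1 h2).2
    nlinarith

/-! ### The affine rescalings -/

section Rescaling

variable {ξ : Fin d → Cn d} {m : Fin d → ℕ} {s : ℝ}

/-- The linear part of the inverse rescaling. -/
noncomputable def rescaleLinear (ξ : Fin d → Cn d) (m : Fin d → ℕ) (s : ℝ) :
    Cn (d + 1) →ₗ[ℂ] Cn (d + 1) where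
  toFun w := consPt (-(Complex.I * s) * w 0) (frameMap ξ (dil (invWeight m) s (tail w)))
  map_add' x y := by
    have h : dil (invWeight m) s (tail (x + y)) =
        dil (invWeight m) s (tail x) + dil (invWeight m) s (tail y) := by
      ext j; simp [dil_apply, mul_add]
    refine ext_zero_tail ?_ ?_
    · simp [mul_add]
    · rw [tail_consPt, h, map_add, tail_add, tail_consPt, tail_consPt]
  map_smul' c x := by
    have h : dil (invWeight m) s (tail (c • x)) = c • dil (invWeight m) s (tail x) := by
      ext j; simp [dil_apply]; ring
    refine ext_zero_tail ?_ ?_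
    · simp; ring
    · rw [RingHom.id_apply, tail_consPt, h, map_smul, tail_smul, tail_consPt]

theorem dil_injective (w : Fin d → ℝ) (hs : 0 < s) : Function.Injective (dil w s) := by
  intro x y hxy
  ext j
  have h := congrArg (fun z : Cn d => z j) hxy
  simp only [dil_apply] at h
  have h0 : ((s ^ w j : ℝ) : ℂ) ≠ 0 := by exact_mod_cast (Real.rpow_pos_of_pos hs _).ne'
  exact mul_left_cancel₀ h0 h

theorem rescaleLinear_injective (hξ : Function.Injective (frameMap ξ)) (hs : 0 < s) :
    Function.Injective (rescaleLinear ξ m s) := by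
  intro x y hxy
  have h0 := congrArg (fun z : Cn (d + 1) => z 0) hxy
  have ht := congrArg tail hxy
  have hs' : (s : ℂ) ≠ 0 := by exact_mod_cast hs.ne'
  refine ext_zero_tail (mul_left_cancel₀ (a := -(Complex.I * s)) ?_ h0) ?_
  · simp [hs']
  · exact dil_injective _ hs (hξ ht)

/-- The inverse of the rescaling: a complex affine automorphism sending `0` to `(i s, 0)`. -/
noncomputable def rescaleEquiv (hξ : Function.Injective (frameMap ξ)) (m : Fin d → ℕ)
    (hs : 0 < s) : Cn (d + 1) ≃ᵃ[ℂ] Cn (d + 1) :=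
  (LinearEquiv.ofInjectiveEndo _ (rescaleLinear_injective (m := m) hξ hs)).toAffineEquiv.trans
    (AffineEquiv.constVAdd ℂ _ (consPt (Complex.I * s) 0))

/-- In the first coordinate this is w₀ ↦ is(1 - w₀), which carries Re w₀ < 1 onto the upper
half-plane. -/
theorem rescaleEquiv_apply (hξ : Function.Injective (frameMap ξ)) (hs : 0 < s) (w : Cn (d + 1)) :
    rescaleEquiv hξ m hs w = consPt ⟨s * (w 0).im, s * (1 - (w 0).re)⟩
      (frameMap ξ (dil (invWeight m) s (tail w))) := by
  have h : rescaleEquiv hξ m hs w = consPt (Complex.I * s) 0 + rescaleLinear ξ m s w := rfl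
  rw [h]
  refine ext_zero_tail ?_ ?_
  · apply Complex.ext <;> simp [rescaleLinear] <;> ring
  · rw [tail_add, tail_consPt, tail_consPt, zero_add]
    rfl

end Rescaling

/-- The rescaled defining functions converge, locally uniformly, to the one of the model domain. -/
theorem tendsto_rescaled {f : Cn d → ℝ} {p q : MvPolynomial (Fin d ⊕ Fin d) ℝ} {N : ℕ} {ρ : ℝ}
    {m : Fin d → ℕ} {Ws : ℕ → Submodule ℂ (Cn d)} {ξ : Fin d → Cn d} {F : ℝ × Cn d → ℝ}
    (hFf : ∀ z, f z = F (0, z)) (hF : HasStrictFDerivAt F (0 : ℝ × Cn d →L[ℝ] ℝ) (0, 0))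
    (hf : IsConvexGerm f ρ) (had : IsAdapted f p m Ws ξ) (hN : ∀ j, m j < N) (hN0 : N ≠ 0)
    (hq : (fun z => f (frameMap ξ z) - polyFun q z) =O[𝓝 0] fun z => ‖z‖ ^ N) (w : Cn (d + 1)) :
    Tendsto (fun t : ℝ × Cn (d + 1) => t.1 ^ (-1 : ℝ) *
        F (t.1 * (t.2 0).im, frameMap ξ (dil (invWeight m) t.1 (tail t.2))) + (t.2 0).re - 1)
      (𝓝[>] 0 ×ˢ 𝓝 w) (𝓝 (modelPart m q (tail w) + (w 0).re - 1)) := by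
  have hs : Tendsto (fun t : ℝ × Cn (d + 1) => t.1) (𝓝[>] 0 ×ˢ 𝓝 w) (𝓝[>] 0) := tendsto_fst
  have hs0 : Tendsto (fun t : ℝ × Cn (d + 1) => t.1) (𝓝[>] 0 ×ˢ 𝓝 w) (𝓝 0) :=
    hs.mono_right nhdsWithin_le_nhds
  have hw : Tendsto (fun t : ℝ × Cn (d + 1) => t.2) (𝓝[>] 0 ×ˢ 𝓝 w) (𝓝 w) := tendsto_snd
  have hz : Tendsto (fun t : ℝ × Cn (d + 1) => tail t.2) (𝓝[>] 0 ×ˢ 𝓝 w) (𝓝 (tail w)) :=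
    (continuous_tail.tendsto w).comp hw
  have h0 : Continuous fun w : Cn (d + 1) => w 0 := by fun_prop
  have hre : Tendsto (fun t : ℝ × Cn (d + 1) => (t.2 0).re) (𝓝[>] 0 ×ˢ 𝓝 w) (𝓝 (w 0).re) :=
    ((Complex.continuous_re.comp h0).tendsto w).comp hw
  have him : Tendsto (fun t : ℝ × Cn (d + 1) => (t.2 0).im) (𝓝[>] 0 ×ˢ 𝓝 w) (𝓝 (w 0).im) :=
    ((Complex.continuous_im.comp h0).tendsto w).comp hw
  have hY : Tendsto (fun t : ℝ × Cn (d + 1) => frameMap ξ (dil (invWeight m) t.1 (tail t.2)))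
      (𝓝[>] 0 ×ˢ 𝓝 w) (𝓝 0) := by
    have := ((continuous_frameMap ξ).tendsto 0).comp (tendsto_dil (invWeight_pos had) hs hz)
    rwa [map_zero] at this
  have h1 := tendsto_modelPart hf had hN hN0 hq hs hz
  -- Both arguments of F tend to the origin and differ by s Im w₀; strict differentiability with
  -- zero differential makes the difference of values o(s).
  have h2 : Tendsto (fun t : ℝ × Cn (d + 1) => t.1 ^ (-1 : ℝ) *
      (F (t.1 * (t.2 0).im, frameMap ξ (dil (invWeight m) t.1 (tail t.2))) -
        F (0, frameMap ξ (dil (invWeight m) t.1 (tail t.2))))) (𝓝[>] 0 ×ˢ 𝓝 w) (𝓝 0) := by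
    have hX : Tendsto (fun t : ℝ × Cn (d + 1) => t.1 * (t.2 0).im) (𝓝[>] 0 ×ˢ 𝓝 w) (𝓝 0) := by
      simpa using hs0.mul him
    have hpair : Tendsto (fun t : ℝ × Cn (d + 1) =>
        ((t.1 * (t.2 0).im, frameMap ξ (dil (invWeight m) t.1 (tail t.2))),
          ((0 : ℝ), frameMap ξ (dil (invWeight m) t.1 (tail t.2))))) (𝓝[>] 0 ×ˢ 𝓝 w)
        (𝓝 (((0 : ℝ), (0 : Cn d)), ((0 : ℝ), (0 : Cn d)))) :=
      (hX.prodMk_nhds hY).prodMk_nhds (tendsto_const_nhds.prodMk_nhds hY)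
    have h3 := hF.isLittleO.comp_tendsto hpair
    have h4 : (fun t : ℝ × Cn (d + 1) =>
        F (t.1 * (t.2 0).im, frameMap ξ (dil (invWeight m) t.1 (tail t.2))) -
          F (0, frameMap ξ (dil (invWeight m) t.1 (tail t.2)))) =o[𝓝[>] 0 ×ˢ 𝓝 w]
        fun t => t.1 * (t.2 0).im := by
      refine (h3.congr_left fun t => by simp).trans_isBigO
        (IsBigO.of_bound 1 (Eventually.of_forall fun t => ?_))
      rw [one_mul]
      simp [Prod.norm_def, mul_nonneg]
    have h5 := (isBigO_refl (fun t : ℝ × Cn (d + 1) => t.1 ^ (-1 : ℝ))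
      (𝓝[>] 0 ×ˢ 𝓝 w)).mul_isLittleO h4
    have h6 : (fun t : ℝ × Cn (d + 1) => t.1 ^ (-1 : ℝ) * (t.1 * (t.2 0).im))
        =O[𝓝[>] 0 ×ˢ 𝓝 w] fun _ => (1 : ℝ) := by
      refine (him.isBigO_one ℝ).congr' ?_ EventuallyEq.rfl
      filter_upwards [hs.eventually self_mem_nhdsWithin] with t ht
      have ht : t.1 ≠ 0 := ne_of_gt ht
      rw [Real.rpow_neg_one]
      field_simp
    exact (isLittleO_one_iff ℝ).1 (h5.trans_isBigO h6)
  have h3 := ((h1.add h2).add hre).sub_const 1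
  rw [add_zero] at h3
  refine h3.congr fun t => ?_
  rw [hFf]
  ring

/-! ### Complex lines and affine images -/

/-- A bounded set contains no complex line. -/
theorem not_containsComplexLine_of_isBounded {n : ℕ} {Ω : Set (Cn n)}
    (hΩ : Bornology.IsBounded Ω) : ¬ ContainsComplexLine Ω := by
  rintro ⟨b, a, ha, h⟩
  obtain ⟨C, hC⟩ := hΩ.exists_norm_le
  have ha' : 0 < ‖a‖ := norm_pos_iff.2 ha
  have h1 := hC _ (h (((C + ‖b‖ + 1) / ‖a‖ : ℝ) : ℂ))
  have hC0 : 0 ≤ C := (norm_nonneg _).trans h1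
  have h2 : ‖(((C + ‖b‖ + 1) / ‖a‖ : ℝ) : ℂ) • a‖ = C + ‖b‖ + 1 := by
    rw [norm_smul, Complex.norm_real, Real.norm_of_nonneg (by positivity)]
    field_simp
  have h3 := norm_sub_le (b + (((C + ‖b‖ + 1) / ‖a‖ : ℝ) : ℂ) • a) b
  rw [add_sub_cancel_left, h2] at h3
  linarith

theorem containsComplexLine_of_image {n : ℕ} {Ω : Set (Cn n)} (A : Cn n ≃ᵃ[ℂ] Cn n)
    (h : ContainsComplexLine (A '' Ω)) : ContainsComplexLine Ω := by
  obtain ⟨b, a, ha, h⟩ := h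
  refine ⟨A.symm b, A.symm.linear a, by simpa using ha, fun ζ => ?_⟩
  obtain ⟨x, hx, hxe⟩ := h ζ
  have : A.symm b + ζ • A.symm.linear a = x := by
    rw [← map_smul, add_comm, ← vadd_eq_add]
    have h2 := A.symm.map_vadd b (ζ • a)
    rw [vadd_eq_add (ζ • a) b, add_comm, ← hxe, A.symm_apply_apply] at h2
    exact h2.symm
  rwa [this]

theorem continuous_affineEquiv {n : ℕ} (A : Cn n ≃ᵃ[ℂ] Cn n) : Continuous A :=
  A.toAffineMap.continuous_of_finiteDimensional

theorem convex_image_affineEquiv {n : ℕ} {Ω : Set (Cn n)} (A : Cn n ≃ᵃ[ℂ] Cn n)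
    (h : Convex ℝ Ω) : Convex ℝ (A '' Ω) := by
  have hdec : ∀ x, A x = A.linear x + A 0 := fun x => by simpa using A.map_vadd 0 x
  have hR : ∀ (a : ℝ) (x : Cn n), A.linear (a • x) = a • A.linear x := fun a x => by
    rw [← Complex.coe_smul, map_smul, Complex.coe_smul]
  rintro _ ⟨x, hx, rfl⟩ _ ⟨y, hy, rfl⟩ a b ha hb hab
  refine ⟨a • x + b • y, h hx hy ha hb hab, ?_⟩
  rw [hdec (a • x + b • y), hdec x, hdec y, map_add, hR, hR]
  calc a • A.linear x + b • A.linear y + A 0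
      = a • A.linear x + b • A.linear y + (a + b) • A 0 := by rw [hab, one_smul]
    _ = _ := by module

theorem isConvexDomain_image {n : ℕ} {Ω : Set (Cn n)} (A : Cn n ≃ᵃ[ℂ] Cn n)
    (h : IsConvexDomain Ω) : IsConvexDomain (A '' Ω) := by
  refine ⟨?_, h.nonempty.image _, convex_image_affineEquiv A h.convex⟩
  have : A '' Ω = A.symm ⁻¹' Ω := A.toEquiv.image_eq_preimage_symm Ω
  rw [this]
  exact h.isOpen.preimage (continuous_affineEquiv A.symm)

/-! ### Geometry of the model domain -/

section Model

variable {P : Cn d → ℝ}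

theorem convexOn_polyDomain_defining (hP : ConvexOn ℝ univ P) :
    ConvexOn ℝ univ fun w : Cn (d + 1) => P (tail w) + (w 0).re - 1 := by
  refine ⟨convex_univ, fun x _ y _ a b ha hb hab => ?_⟩
  have h := hP.2 (mem_univ (tail x)) (mem_univ (tail y)) ha hb hab
  simp only [tail_add, tail_smul, smul_eq_mul, PiLp.add_apply, PiLp.smul_apply, Complex.add_re,
    Complex.real_smul, Complex.re_ofReal_mul] at h ⊢
  have : a * (P (tail x) + (x 0).re - 1) + b * (P (tail y) + (y 0).re - 1) =
      a * P (tail x) + b * P (tail y) + (a * (x 0).re + b * (y 0).re) - (a + b) := by ring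
  rw [this, hab]
  linarith

theorem polyDomain_eq (P : Cn d → ℝ) :
    polyDomain P = {w : Cn (d + 1) | P (tail w) + (w 0).re - 1 < 0} := by
  ext w
  simp only [polyDomain, mem_ofPred_eq]
  constructor <;> intro h <;> linarith

theorem continuous_polyDomain_defining (hc : Continuous P) :
    Continuous fun w : Cn (d + 1) => P (tail w) + (w 0).re - 1 := by
  have h0 : Continuous fun w : Cn (d + 1) => w 0 := by fun_prop
  exact ((hc.comp continuous_tail).add (Complex.continuous_re.comp h0)).sub continuous_const

theorem zero_mem_polyDomain (hP0 : P 0 = 0) : (0 : Cn (d + 1)) ∈ polyDomain P := by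
  change ((0 : Cn (d + 1)) 0).re < 1 - P (tail 0)
  rw [tail_zero, hP0]
  simp

theorem isConvexDomain_polyDomain (hc : Continuous P) (hP : ConvexOn ℝ univ P) (hP0 : P 0 = 0) :
    IsConvexDomain (polyDomain P) := by
  refine ⟨?_, ⟨0, zero_mem_polyDomain hP0⟩, ?_⟩
  · rw [polyDomain_eq]
    exact isOpen_lt (continuous_polyDomain_defining hc) continuous_const
  · rw [polyDomain_eq]
    simpa using (convexOn_polyDomain_defining hP).convex_lt 0

/-- On a complex line in the domain w₀ must be constant, so P is bounded along a complex direction,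
which can be scaled to have first nonzero coordinate 1. There P ≥ 1, so by convexity and P(0) = 0 it
must be unbounded on the ray through it. -/
theorem not_containsComplexLine_polyDomain (hP : ConvexOn ℝ univ P) (hnn : ∀ z, 0 ≤ P z)
    (hP0 : P 0 = 0) (hZ : ∀ (j : Fin d) (z : Cn d), (∀ l < j, z l = 0) → z j = 1 → 1 ≤ P z) :
    ¬ ContainsComplexLine (polyDomain P) := by
  rintro ⟨b, a, ha, h⟩
  have h' : ∀ ζ : ℂ, (b 0 + ζ * a 0).re < 1 - P (tail b + ζ • tail a) := by
    intro ζ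
    have h1 : ((b + ζ • a) 0).re < 1 - P (tail (b + ζ • a)) := h ζ
    simpa using h1
  have ha0 : a 0 = 0 := by
    by_contra hne
    have h1 := h' ((1 - b 0) / a 0)
    rw [div_mul_cancel₀ _ hne, add_sub_cancel, Complex.one_re] at h1
    linarith [hnn (tail b + ((1 - b 0) / a 0) • tail a)]
  have hta : tail a ≠ 0 := by
    intro ht
    exact ha (ext_zero_tail (by simpa using ha0) (by simpa using ht))
  obtain ⟨j, hj, hlow⟩ := exists_first_ne_zero hta
  set a' : Cn d := (tail a j)⁻¹ • tail a with ha'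
  have hbd : ∀ ζ : ℂ, P (tail b + ζ • a') < 1 - (b 0).re := by
    intro ζ
    have h1 := h' (ζ * (tail a j)⁻¹)
    rw [ha0, mul_zero, add_zero, mul_smul] at h1
    rw [ha']
    linarith
  -- The point t a' is the midpoint of tail b + 2t a', where P < 1 - Re b₀, and -tail b: this moves
  -- the bound to the line through 0.
  set C := 1 / 2 * (1 - (b 0).re) + 1 / 2 * P (-tail b) with hC
  have hbd' : ∀ t : ℝ, P (t • a') ≤ C := by
    intro t
    have h1 := hP.2 (mem_univ (tail b + ((2 * t : ℝ) : ℂ) • a')) (mem_univ (-tail b))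
      (by norm_num : (0 : ℝ) ≤ 1 / 2) (by norm_num : (0 : ℝ) ≤ 1 / 2) (by norm_num)
    have e : (1 / 2 : ℝ) • (tail b + ((2 * t : ℝ) : ℂ) • a') + (1 / 2 : ℝ) • (-tail b) =
        t • a' := by
      rw [Complex.coe_smul]
      module
    rw [e] at h1
    simp only [smul_eq_mul] at h1
    have h2 := hbd ((2 * t : ℝ) : ℂ)
    rw [hC]
    linarith
  have h1 : 1 ≤ P a' := hZ j a' (fun l hl => by
    rw [ha', PiLp.smul_apply, hlow l hl, smul_zero]) (by
    rw [ha', PiLp.smul_apply, smul_eq_mul, inv_mul_cancel₀ hj])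
  have hC1 : 1 ≤ C := by simpa using h1.trans (by simpa using hbd' 1)
  have h2 := hP.2 (mem_univ ((2 * C) • a')) (mem_univ 0)
    (by positivity : (0 : ℝ) ≤ 1 / (2 * C))
    (by rw [sub_nonneg, div_le_one (by positivity)]; linarith : (0 : ℝ) ≤ 1 - 1 / (2 * C))
    (by ring)
  rw [smul_zero, add_zero, smul_smul, hP0, smul_zero, add_zero,
    one_div_mul_cancel (by positivity), one_smul, smul_eq_mul] at h2
  have h3 : 1 / (2 * C) * P ((2 * C) • a') ≤ 1 / (2 * C) * C := by
    gcongr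
    exact hbd' _
  have h4 : 1 / (2 * C) * C = 1 / 2 := by field_simp
  linarith

theorem unitDisk_subset_polyDomain (hP0 : P 0 = 0)
    (hD : ∀ (j : Fin d) (ζ : ℂ), ‖ζ‖ < 1 → P (EuclideanSpace.single j ζ) < 1) (i : Fin (d + 1)) :
    unitDisk i ⊆ polyDomain P := by
  rintro w ⟨ζ, hζ, rfl⟩
  change ((EuclideanSpace.single i ζ : Cn (d + 1)) 0).re < 1 - P (tail _)
  refine Fin.cases ?_ (fun j => ?_) i
  · have : tail (EuclideanSpace.single (0 : Fin (d + 1)) ζ) = 0 := by ext l; simp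
    rw [this, hP0]
    simpa using (Complex.re_le_norm ζ).trans_lt hζ
  · have : tail (EuclideanSpace.single j.succ ζ) = EuclideanSpace.single j ζ := by
      ext l; simp [PiLp.single_apply]
    rw [this]
    have h2 := hD j ζ hζ
    have h3 : (EuclideanSpace.single j.succ ζ : Cn (d + 1)) 0 = 0 := by
      simp [(Fin.succ_ne_zero j).symm]
    rw [h3, Complex.zero_re]
    linarith

theorem planeZ_inter_polyDomain (hnn : ∀ z, 0 ≤ P z)
    (hZ : ∀ (j : Fin d) (z : Cn d), (∀ l < j, z l = 0) → z j = 1 → 1 ≤ P z) (i : Fin (d + 1)) :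
    planeZ i ∩ polyDomain P = ∅ := by
  rw [Set.eq_empty_iff_forall_notMem]
  rintro w ⟨⟨hlow, hi⟩, hw⟩
  have hw : (w 0).re < 1 - P (tail w) := hw
  revert hlow hi
  refine Fin.cases ?_ (fun j => ?_) i
  · intro _ hi
    rw [hi, Complex.one_re] at hw
    linarith [hnn (tail w)]
  · intro hlow hi
    rw [hlow 0 (Fin.succ_pos j), Complex.zero_re] at hw
    have := hZ j (tail w) (fun l hl => hlow l.succ (Fin.succ_lt_succ_iff.2 hl)) hi
    linarith

end Model

/-! ### The rescaling theorem -/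

theorem IsGraphNear.of_hasLineType {Ω : Set (Cn (d + 1))} {ξ : Cn (d + 1)}
    (hΩ : IsConvexDomain Ω) (hξ : ξ ∈ frontier Ω) {m : Fin d → ℕ∞} (hm : HasLineType Ω ξ m) :
    ∃ (A : Cn (d + 1) ≃ᵃ[ℂ] Cn (d + 1)) (U V : Set ℝ) (W : Set (Cn d)) (F : ℝ × Cn d → ℝ),
      A ξ = 0 ∧ IsGraphNear (A '' Ω) U V W F ∧ m = typeAtZero fun z => F (0, z) := by
  obtain ⟨A, U, V, W, F, hA, hpos, hU, hU0, hV, hV0, hW, hW0, hF, -, heq, hm⟩ := hm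
  refine ⟨A, U, V, W, F, hA, ⟨convex_image_affineEquiv A hΩ.convex, fun w hw => hpos hw, ?_, hU,
    hU0, hV, hV0, hW, hW0, hF, fun w h1 h2 h3 => ?_⟩, hm⟩
  · rw [← hA]
    exact image_closure_subset_closure_image (continuous_affineEquiv A)
      (mem_image_of_mem A (frontier_subset_closure hξ))
  · have := Set.ext_iff.1 heq w
    simp only [mem_inter_iff, mem_ofPred_eq, h1, h2, h3, and_self, and_true, true_and] at this
    exact this

end RescaleConvex

open RescaleConvex in
theorem theorem3p1 (d : ℕ) (Ω : Set (RescaleConvex.Cn (d + 1)))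
    (hΩ : RescaleConvex.IsConvexDomain Ω) (hbdd : Bornology.IsBounded Ω)
    (hsmooth : RescaleConvex.HasSmoothBoundary Ω)
    (ξ : RescaleConvex.Cn (d + 1)) (hξ : ξ ∈ frontier Ω)
    (m : Fin d → ℕ) (hm : RescaleConvex.HasLineType Ω ξ (fun j => (m j : ℕ∞))) :
    ∃ (x : ℕ → RescaleConvex.Cn (d + 1))
      (A : ℕ → RescaleConvex.Cn (d + 1) ≃ᵃ[ℂ] RescaleConvex.Cn (d + 1))
      (P : RescaleConvex.Cn d → ℝ),
      (∀ n, x n ∈ Ω) ∧ Tendsto x atTop (𝓝 ξ) ∧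
      RescaleConvex.TendstoX₀ (fun n => A n '' Ω) (fun n => A n (x n))
        (RescaleConvex.polyDomain P) 0 ∧
      RescaleConvex.IsRealPolynomial P ∧ ConvexOn ℝ univ P ∧ (∀ z, 0 ≤ P z) ∧ P 0 = 0 ∧
      RescaleConvex.IsWeightedHomogeneous m P ∧
      (∀ i : Fin (d + 1), RescaleConvex.unitDisk i ⊆ RescaleConvex.polyDomain P) ∧
      (∀ i : Fin (d + 1), RescaleConvex.planeZ i ∩ RescaleConvex.polyDomain P = ∅) := by
  obtain ⟨A, U, V, W, F, hA, hg, htype⟩ := IsGraphNear.of_hasLineType hΩ hξ hm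
  obtain ⟨ρ, hf⟩ := hg.isConvexGerm
  obtain ⟨N, hN0, hN⟩ : ∃ N : ℕ, N ≠ 0 ∧ ∀ j, m j < N :=
    ⟨∑ j, m j + 1, by lia, fun j => Nat.lt_succ_of_le
      (Finset.single_le_sum (f := m) (fun _ _ => Nat.zero_le _) (Finset.mem_univ j))⟩
  obtain ⟨p, hp⟩ := exists_taylor_polyFun hf.contDiffAt N
  obtain ⟨Ws, v, had⟩ := exists_isAdapted hf.contDiffAt hf.map_zero hf.pos hf.convexOn hf.nonneg
    hp (fun j => congrFun htype j) hN
  obtain ⟨q, hq⟩ := exists_taylor_polyFun (contDiffAt_comp_frameMap hf v) N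
  have hv := frameMap_injective had
  have hconv := modelPart_convexOn hf had hN hN0 hq
  have hnn := modelPart_nonneg hf had hN hN0 hq
  have hP0 := modelPart_zero m q
  have hZ : ∀ (j : Fin d) (z : Cn d), (∀ l < j, z l = 0) → z j = 1 → 1 ≤ modelPart m q z :=
    fun j z => one_le_modelPart hf had hN hp hq
  have hE := continuous_polyDomain_defining (continuous_modelPart m q)
  obtain ⟨s₀, hs₀, hs₀V⟩ : ∃ s₀ > 0, ∀ s ∈ Ioo 0 s₀, s ∈ V := by
    obtain ⟨ε, hε, hεV⟩ := hg.exists_Ioo_subset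
    exact ⟨ε, hε, fun s hs => hεV ⟨by linarith [hs.1], hs.2⟩⟩
  -- The 2 in the denominator keeps s n strictly below s₀, so that s n ∈ V for every n.
  let s : ℕ → ℝ := fun n => s₀ / (n + 2)
  have hs : ∀ n, 0 < s n := fun n => by positivity
  have hsV : ∀ n, s n ∈ V := fun n => hs₀V _ ⟨hs n, div_lt_self hs₀ (by
    have : (0 : ℝ) ≤ n := Nat.cast_nonneg n
    linarith)⟩
  have hs0 : Tendsto s atTop (𝓝[>] 0) := by
    refine tendsto_nhdsWithin_iff.2 ⟨?_, Eventually.of_forall hs⟩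
    exact tendsto_const_nhds.div_atTop
      (tendsto_atTop_add_const_right _ _ tendsto_natCast_atTop_atTop)
  have hΦ0 : ∀ n, rescaleEquiv hv m (hs n) 0 = consPt ⟨0, s n⟩ 0 := by
    intro n
    have h0 : dil (invWeight m) (s n) (0 : Cn d) = 0 := by ext j; simp [dil_apply]
    rw [rescaleEquiv_apply, tail_zero, h0, map_zero]
    simp
  have hx : ∀ n, A.symm (rescaleEquiv hv m (hs n) 0) ∈ Ω := by
    intro n
    have h1 : consPt ⟨0, s n⟩ 0 ∈ A '' Ω :=
      (hg.consPt_mem_iff hg.zero_mem_U (hsV n) hg.zero_mem_W).2 (by rw [hg.map_zero]; exact hs n)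
    obtain ⟨y, hy, hye⟩ := h1
    rw [hΦ0, ← hye, A.symm_apply_apply]
    exact hy
  have hAx : ∀ n, (A.trans (rescaleEquiv hv m (hs n)).symm)
      (A.symm (rescaleEquiv hv m (hs n) 0)) = 0 := by
    intro n
    simp
  -- With Φ_n the inverse rescaling, x_n = A⁻¹(Φ_n 0) = A⁻¹(i s_n, 0) and A_n = Φ_n⁻¹ ∘ A, so A_n
  -- x_n = 0.
  refine ⟨fun n => A.symm (rescaleEquiv hv m (hs n) 0),
    fun n => A.trans (rescaleEquiv hv m (hs n)).symm, modelPart m q, hx, ?_, ?_,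
    isRealPolynomial_modelPart m q, hconv, hnn, hP0, isWeightedHomogeneous_modelPart m q,
    unitDisk_subset_polyDomain hP0 fun j ζ hζ => modelPart_single_lt_one hf had hN hp hq hζ,
    planeZ_inter_polyDomain hnn hZ⟩
  · have h1 : Tendsto (fun n => rescaleEquiv hv m (hs n) 0) atTop (𝓝 0) := by
      simp only [hΦ0]
      have h2 : Continuous fun s : ℝ => (s : ℂ) • consPt Complex.I (0 : Cn d) := by fun_prop
      have h3 := (h2.tendsto 0).comp (hs0.mono_right nhdsWithin_le_nhds)
      simp only [Complex.ofReal_zero, zero_smul] at h3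
      refine h3.congr fun n => ?_
      refine ext_zero_tail ?_ ?_
      · apply Complex.ext <;> simp
      · simp
    have h2 := ((continuous_affineEquiv A.symm).tendsto 0).comp h1
    have h3 : A.symm 0 = ξ := by rw [← hA, A.symm_apply_apply]
    rw [h3] at h2
    exact h2
  · refine ⟨fun n => ⟨isConvexDomain_image _ hΩ, fun h => not_containsComplexLine_of_isBounded hbdd
      (containsComplexLine_of_image _ h), mem_image_of_mem _ (hx n)⟩,
      ⟨isConvexDomain_polyDomain (continuous_modelPart m q) hconv hP0,
        not_containsComplexLine_polyDomain hconv hnn hP0 hZ, zero_mem_polyDomain hP0⟩, ?_, ?_⟩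
    · refine localHausdorffTendsto_of_sublevel (Es := fun n w => s n ^ (-1 : ℝ) *
        F (s n * (w 0).im, frameMap v (dil (invWeight m) (s n) (tail w))) + (w 0).re - 1) hE
        (convexOn_polyDomain_defining hconv) (by simp [hP0]) (polyDomain_eq _) fun R δ hδ => ?_
      -- The convergence is joint in (s, w) at each w₀, so compactness of the ball makes it uniform
      -- there. The same neighbourhoods ensure that the rescaled points lie where the domain is a
      -- graph.
      have hloc : ∀ w₀ ∈ Metric.closedBall (0 : Cn (d + 1)) R,
          {t : ℝ × Cn (d + 1) | (t.1 * (t.2 0).im ∈ U ∧ t.1 * (1 - (t.2 0).re) ∈ V ∧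
            frameMap v (dil (invWeight m) t.1 (tail t.2)) ∈ W) ∧
            |t.1 ^ (-1 : ℝ) * F (t.1 * (t.2 0).im, frameMap v (dil (invWeight m) t.1 (tail t.2))) +
              (t.2 0).re - 1 - (modelPart m q (tail t.2) + (t.2 0).re - 1)| < δ}
            ∈ 𝓝[>] 0 ×ˢ 𝓝 w₀ := by
        intro w₀ _
        have hfst : Tendsto (fun t : ℝ × Cn (d + 1) => t.1) (𝓝[>] 0 ×ˢ 𝓝 w₀) (𝓝 0) :=
          tendsto_fst.mono_right nhdsWithin_le_nhds
        have hcoord : Tendsto (fun t : ℝ × Cn (d + 1) => t.2 0) (𝓝[>] 0 ×ˢ 𝓝 w₀) (𝓝 (w₀ 0)) := by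
          have h0 : Continuous fun w : Cn (d + 1) => w 0 := by fun_prop
          exact (h0.tendsto w₀).comp tendsto_snd
        have e1 : Tendsto (fun t : ℝ × Cn (d + 1) => t.1 * (t.2 0).im) (𝓝[>] 0 ×ˢ 𝓝 w₀) (𝓝 0) := by
          simpa using hfst.mul ((Complex.continuous_im.tendsto _).comp hcoord)
        have e2 : Tendsto (fun t : ℝ × Cn (d + 1) => t.1 * (1 - (t.2 0).re)) (𝓝[>] 0 ×ˢ 𝓝 w₀)
            (𝓝 0) := by
          simpa using hfst.mul (((Complex.continuous_re.tendsto _).comp hcoord).const_sub 1)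
        have e3 : Tendsto (fun t : ℝ × Cn (d + 1) =>
            frameMap v (dil (invWeight m) t.1 (tail t.2))) (𝓝[>] 0 ×ˢ 𝓝 w₀) (𝓝 0) := by
          have := ((continuous_frameMap v).tendsto 0).comp (tendsto_dil (invWeight_pos had)
            tendsto_fst ((continuous_tail.tendsto w₀).comp
              (tendsto_snd (f := 𝓝[>] (0 : ℝ)) (g := 𝓝 w₀))))
          rwa [map_zero] at this
        have e4 := (tendsto_rescaled (fun _ => rfl) hg.hasStrictFDerivAt hf had hN hN0 hq w₀).sub
          ((hE.tendsto w₀).comp tendsto_snd)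
        rw [sub_self] at e4
        filter_upwards [e1.eventually (hg.isOpen_U.mem_nhds hg.zero_mem_U),
          e2.eventually (hg.isOpen_V.mem_nhds hg.zero_mem_V),
          e3.eventually (hg.isOpen_W.mem_nhds hg.zero_mem_W),
          e4.eventually (Metric.ball_mem_nhds 0 hδ)] with t h1 h2 h3 h4
        exact ⟨⟨h1, h2, h3⟩, by simpa using h4⟩
      obtain ⟨S, hS, K, hK, hSK⟩ := mem_prod_iff.1
        ((isCompact_closedBall (0 : Cn (d + 1)) R).mem_prod_nhdsSet_of_forall hloc)
      filter_upwards [hs0 hS] with n hn w hw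
      obtain ⟨⟨h1, h2, h3⟩, h4⟩ := hSK (mk_mem_prod hn (subset_of_mem_nhdsSet hK hw))
      refine ⟨?_, h4⟩
      have hmem : w ∈ (A.trans (rescaleEquiv hv m (hs n)).symm) '' Ω ↔
          rescaleEquiv hv m (hs n) w ∈ A '' Ω := by
        constructor
        · rintro ⟨y, hy, rfl⟩
          exact ⟨y, hy, by simp⟩
        · rintro ⟨y, hy, hye⟩
          exact ⟨y, hy, by simp [hye]⟩
      rw [hmem, rescaleEquiv_apply, hg.consPt_mem_iff h1 h2 h3, Real.rpow_neg_one]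
      have hsn := hs n
      constructor
      · intro h
        have h5 := (inv_mul_lt_iff₀ hsn).2 h
        linarith
      · intro h
        refine (inv_mul_lt_iff₀ hsn).1 ?_
        linarith
    · simp only [hAx]
      exact tendsto_const_nhds
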